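/- Let $G$ be a (finite-dimensional real) Lie group with unit $e$ and Lie algebra $\mathfrak g=T_eG$, let $l_g$ denote left translation by $g$, and let $\operatorname{Ad}(g)=(d(h\mapsto ghg^{-1}))_e:\mathfrak g\to\mathfrak g$. A left-invariant (sub-)Finsler metric on $G$ is given by a linear subspace $\mathfrak p\subset\mathfrak g$ that generates the Lie algebra $\mathfrak g$, and a norm $F$ on $\mathfrak p$; put $U=\{u\in\mathfrak p: F(u)\le 1\}$. For $\psi\in T_g^*G$ and $u\in\mathfrak g$ let $H(g,\psi,u)=\psi((dl_g)(u))$. A normal extremal is a curve $g:\mathbb R\to G$ for which there are a measurable control $u:\mathbb R\to U$ and a nowhere vanishing, locally absolutely continuous covector function $\psi(t)\in T^*_{g(t)}G$ along $g$ (itself locally absolutely continuous) satisfying the Pontryagin maximum principle of the time-optimal problem for $\dot g=dl_g(u)$, $u\in U$: for almost every $t$, in canonical coordinates of $T^*G$, $$\dot g=\frac{\partial H}{\partial\psi},\qquad \dot\psi=-\frac{\partial H}{\partial g}\qquad\text{with } u=u(t),$$ and $H(g(t),\psi(t),u(t))=\max_{w\in U}H(g(t),\psi(t),w)$, this maximum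 being positive. Theorem. Let $g:\mathbb R\to G$ be a normal extremal with $g(0)=e$. Then $g$ is parametrized by arc length, i.e. $g(t)^{-1}g'(t):=dl_{g(t)^{-1}}(g'(t))\in\mathfrak p$ and $F(g(t)^{-1}g'(t))=1$ for almost every $t$, and there is a covector $\psi_0\in\mathfrak g^*$ with $\max_{v\in U}\psi_0(v)=1$ such that the following hold. 1. There is a choice, for every $h\in G$, of an element $w(h)\in U$ with $\psi_0(\operatorname{Ad}(h)(w(h)))=\max_{w\in U}\psi_0(\operatorname{Ad}(h)(w))$ such that $g$ is a Lipschitz integral curve of the vector field $$v(h)=dl_h(u(h)),\qquad u(h)=\psi_0(\operatorname{Ad}(h)(w(h)))\,w(h),\qquad h\in G,$$ that is, $g$ is Lipschitz (with respect to the smooth structure of $G$, uniformly on $\mathbb R$ in left-translated charts) and $g'(t)=v(g(t))$ for almost every $t\in\mathbb R$. 2. (Conservation law) With $\psi(t):=(\operatorname{Ad}g(t))^*(\psi_0)=\psi_0\circ\operatorname{Ad}(g(t))$, one has $\psi(t)(g(t)^{-1}g'(t))=1$ for every $t\in\mathbb R$ at which $g$ is differentiable (hence for almost every $t$). -/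

import Mathlib

open Set MeasureTheory
open scoped Manifold ContDiff

noncomputable section

namespace SubFinsler

/-! Throughout, `G` is a real Lie group modelled on `E`, its Lie algebra `𝔤 = T_e G` is Mathlib's
`GroupLieAlgebra`, and `mulInvariantVectorField u g` is `dl_g(u)`. -/

section Defs

variable {E : Type*} [NormedAddCommGroup E] [NormedSpace ℝ E]
  {G : Type*} [TopologicalSpace G] [ChartedSpace E G] [Group G]

variable (E G) in
/-- The data defining a left-invariant (sub-)Finsler metric on `G`: a norm `F` on a linear subspace
`p` of the Lie algebra `𝔤`, where `p` generates `𝔤`, i.e. the only linear subspace of `𝔤` that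
contains `p` and is closed under the Lie bracket is `𝔤` itself. (Finsler: `p = 𝔤`.) -/
structure LeftInvariantMetric where
  /-- The subspace of admissible directions at the unit. -/
  p : Submodule ℝ (GroupLieAlgebra 𝓘(ℝ, E) G)
  /-- The norm. -/
  F : Seminorm ℝ p
  eq_zero_of_F : ∀ v : p, F v = 0 → v = 0
  generates : ∀ q : Submodule ℝ (GroupLieAlgebra 𝓘(ℝ, E) G), p ≤ q →
    (∀ v ∈ q, ∀ w ∈ q, ⁅v, w⁆ ∈ q) → q = ⊤

/-- The control region `U = {u ∈ p : F u ≤ 1}`, the closed unit ball of `F`. -/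
def LeftInvariantMetric.unitBall (D : LeftInvariantMetric E G) :
    Set (GroupLieAlgebra 𝓘(ℝ, E) G) :=
  {u | ∃ h : u ∈ D.p, D.F ⟨u, h⟩ ≤ 1}

/-! ### The Hamiltonian system on the cotangent bundle -/

/-- `H(g, ψ, u) = ψ(dl_g(u))` for `g ∈ G`, `ψ ∈ T*_g G`, `u ∈ 𝔤`. -/
def hamiltonian (g : G) (ψ : TangentSpace 𝓘(ℝ, E) g →L[ℝ] ℝ)
    (u : GroupLieAlgebra 𝓘(ℝ, E) G) : ℝ :=
  ψ (mulInvariantVectorField u g)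

/-- The coordinates `λ ∈ E*` of a covector `ψ ∈ T*_g G` in the chart `φ` around `x₀`:
`ψ = λ ∘ dφ_g`, that is `λ = ψ ∘ (dφ_g)⁻¹`. Meaningful for `g` in the domain of the chart. -/
def covectorCoord (x₀ g : G) (ψ : TangentSpace 𝓘(ℝ, E) g →L[ℝ] ℝ) : E →L[ℝ] ℝ :=
  ψ.comp (mfderiv 𝓘(ℝ, E) 𝓘(ℝ, E) (extChartAt 𝓘(ℝ, E) x₀) g).inverse

/-- The Hamiltonian in the canonical coordinates `(x, λ) ∈ E × E*` given by the chart `φ` around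
`x₀`: `H(φ⁻¹(x), λ ∘ dφ, u)`. -/
def chartHamiltonian (x₀ : G) (x : E) (l : E →L[ℝ] ℝ)
    (u : GroupLieAlgebra 𝓘(ℝ, E) G) : ℝ :=
  hamiltonian ((extChartAt 𝓘(ℝ, E) x₀).symm x)
    (l.comp (mfderiv 𝓘(ℝ, E) 𝓘(ℝ, E) (extChartAt 𝓘(ℝ, E) x₀)
      ((extChartAt 𝓘(ℝ, E) x₀).symm x))) u

/-- The Hamiltonian system `x' = ∂H/∂λ`, `λ' = -∂H/∂x` with parameter `u`, holds at time `t` in the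
canonical coordinates of the chart around `x₀`, for the curve `s ↦ (g s, ψ s)` in `T*G`.
(`∂H/∂λ`, an element of `E**`, is identified with a vector `x'` of `E`.) -/
def HamiltonianSystemAt (x₀ : G) (g : ℝ → G) (ψ : ∀ t, TangentSpace 𝓘(ℝ, E) (g t) →L[ℝ] ℝ)
    (u : GroupLieAlgebra 𝓘(ℝ, E) G) (t : ℝ) : Prop :=
  (∃ x' : E, HasDerivAt (fun s ↦ extChartAt 𝓘(ℝ, E) x₀ (g s)) x' t ∧
    ∀ m : E →L[ℝ] ℝ, m x' =
      fderiv ℝ (fun l ↦ chartHamiltonian x₀ (extChartAt 𝓘(ℝ, E) x₀ (g t)) l u)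
        (covectorCoord x₀ (g t) (ψ t)) m) ∧
  HasDerivAt (fun s ↦ covectorCoord x₀ (g s) (ψ s))
    (-fderiv ℝ (fun x ↦ chartHamiltonian x₀ x (covectorCoord x₀ (g t) (ψ t)) u)
      (extChartAt 𝓘(ℝ, E) x₀ (g t))) t

/-- The curve `t ↦ (g t, ψ t)` in `T*G` is (locally) absolutely continuous: `g` is continuous, and
in the canonical coordinates of every chart the curve is absolutely continuous on every compact
interval that `g` maps into the chart. -/
def IsAbsolutelyContinuousLift (g : ℝ → G)
    (ψ : ∀ t, TangentSpace 𝓘(ℝ, E) (g t) →L[ℝ] ℝ) : Prop :=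
  Continuous g ∧ ∀ (x₀ : G) (a b : ℝ), a ≤ b →
    (∀ t ∈ Icc a b, g t ∈ (extChartAt 𝓘(ℝ, E) x₀).source) →
      AbsolutelyContinuousOnInterval (fun t ↦ extChartAt 𝓘(ℝ, E) x₀ (g t)) a b ∧
      AbsolutelyContinuousOnInterval (fun t ↦ covectorCoord x₀ (g t) (ψ t)) a b

/-- The curve `g`, with control `u` and covector function `ψ(t) ∈ T*_{g(t)} G`, satisfies the
Pontryagin maximum principle for the time-optimal problem of the control system `g' = dl_g(u)`,
`u ∈ U`: `u` is a measurable control with values in `U`, `ψ` is absolutely continuous and nowhere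
zero, and at almost every time the Hamiltonian system holds (in every chart) and `u(t)` maximizes
`H(g(t), ψ(t), ·)` over `U`. -/
structure SatisfiesPMP (D : LeftInvariantMetric E G) (g : ℝ → G)
    (u : ℝ → GroupLieAlgebra 𝓘(ℝ, E) G)
    (ψ : ∀ t, TangentSpace 𝓘(ℝ, E) (g t) →L[ℝ] ℝ) : Prop where
  measurable_control : AEStronglyMeasurable u volume
  control_mem : ∀ t, u t ∈ D.unitBall
  absolutelyContinuous : IsAbsolutelyContinuousLift g ψ
  ne_zero : ∀ t, ψ t ≠ 0
  hamiltonian_system : ∀ x₀ : G, ∀ᵐ t : ℝ,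
    g t ∈ (extChartAt 𝓘(ℝ, E) x₀).source → HamiltonianSystemAt x₀ g ψ (u t) t
  maximum : ∀ᵐ t : ℝ, IsMaxOn (hamiltonian (g t) (ψ t)) D.unitBall (u t)

/-- A normal extremal: a curve satisfying the maximum principle with some control `u` and covector
function `ψ` for which the maximal value `H(g(t), ψ(t), u(t))` is positive. -/
def IsNormalExtremal (D : LeftInvariantMetric E G) (g : ℝ → G) : Prop :=
  ∃ (u : ℝ → GroupLieAlgebra 𝓘(ℝ, E) G) (ψ : ∀ t, TangentSpace 𝓘(ℝ, E) (g t) →L[ℝ] ℝ),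
    SatisfiesPMP D g u ψ ∧ ∀ᵐ t : ℝ, 0 < hamiltonian (g t) (ψ t) (u t)

/-! ### The adjoint representation, velocities and integral curves -/

/-- `Ad(g) = (dI(g))_e : 𝔤 → 𝔤`, where `I(g)(h) = g h g⁻¹`. (The derivative takes values in the
tangent space at `g * 1 * g⁻¹ = 1`.) -/
def Ad (g : G) : GroupLieAlgebra 𝓘(ℝ, E) G →L[ℝ] GroupLieAlgebra 𝓘(ℝ, E) G :=
  mfderiv 𝓘(ℝ, E) 𝓘(ℝ, E) (fun h : G ↦ g * h * g⁻¹) (1 : G)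

variable (E) in
/-- `g(t)⁻¹ g'(t) = dl_{g(t)⁻¹}(g'(t)) ∈ 𝔤`. Meaningful if `g` is differentiable at `t`. -/
def leftVelocity (g : ℝ → G) (t : ℝ) : GroupLieAlgebra 𝓘(ℝ, E) G :=
  mfderiv 𝓘(ℝ, E) 𝓘(ℝ, E) (fun h : G ↦ (g t)⁻¹ * h) (g t)
    (mfderiv 𝓘(ℝ, ℝ) 𝓘(ℝ, E) g t (1 : ℝ))

variable (E) in
/-- `g` is Lipschitz with respect to the smooth structure of the Lie group, uniformly on `ℝ`: for
close times `s`, `t` the element `g(s)⁻¹ g(t)` lies in the chart around the unit, at a distance at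
most `K |t - s|` from the unit. Equivalently, `g` is Lipschitz for the distance of some (any)
left-invariant Riemannian metric; in particular `g` is locally Lipschitz in every chart. -/
def IsLipschitzCurve (g : ℝ → G) : Prop :=
  ∃ K ε : ℝ, 0 < ε ∧ ∀ s t : ℝ, |t - s| < ε →
    (g s)⁻¹ * g t ∈ (extChartAt 𝓘(ℝ, E) (1 : G)).source ∧
    ‖extChartAt 𝓘(ℝ, E) (1 : G) ((g s)⁻¹ * g t) - extChartAt 𝓘(ℝ, E) (1 : G) 1‖ ≤ K * |t - s|

/-- `g` is a Lipschitz integral curve of the (possibly discontinuous) vector field `v`: it is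
Lipschitz and `g'(t) = v(g(t))` for almost every `t`. -/
def IsLipschitzIntegralCurve (g : ℝ → G) (v : ∀ h : G, TangentSpace 𝓘(ℝ, E) h) : Prop :=
  IsLipschitzCurve E g ∧
    ∀ᵐ t : ℝ, HasMFDerivAt 𝓘(ℝ, ℝ) 𝓘(ℝ, E) g t ((1 : ℝ →L[ℝ] ℝ).smulRight (v (g t)))

end Defs

end SubFinsler

end

noncomputable section

namespace SubFinsler

open Filter Topology

/-! ### Absolutely continuous curves -/

/-! The covector `ψ(t)` is carried to the Lie algebra in two ways: the body momentum `ψ ∘ dl_g` and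
the space momentum `ψ ∘ dr_g`. In canonical coordinates the Hamiltonian is `λ(L_u(y))`, with `L_u`
the left-invariant field, so the pairing of `λ` with any field commuting with `L_u` has zero
derivative. Right-invariant fields commute with left-invariant ones (`fderiv_leftCoord_rightCoord`,
from associativity and symmetry of second derivatives), so the space momentum is constant:
`SatisfiesPMP.spaceMomentum_eq`. As `dl_g = dr_g ∘ Ad(g)`, the body momentum is this constant
composed with `Ad(g(t))`.

The maximal Hamiltonian is the support function of `U` at the body momentum. It is absolutely
continuous, and it dominates the Hamiltonian with control frozen at `u(t)`, with equality at time
`t`; both therefore have the same derivative there, namely zero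
(`SatisfiesPMP.supportFunction_bodyMomentum_eq`). Dividing by this positive constant gives `ψ₀`. A
maximizer of a linear form with positive maximum is a unit vector, hence arc length.

The vector field needs one maximizer per point of `G`, whereas the control is indexed by time. Two
times at which the curve is at the same point with different velocities form a transverse
self-intersection, since both velocities have value 1 under the same covector. Such pairs are
countable (`countable_transverse_selfIntersections`), so almost every visited position determines
its control (`ae_forall_velocity_eq`).

Bounded left velocity gives the uniform Lipschitz bound (`isLipschitzCurve_of_ae_hasMFDerivAt`).
Continuity of the momentum extends the conservation law from almost every time to every point of
differentiability (`apply_leftVelocity_eq_one`). -/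

theorem _root_.AbsolutelyContinuousOnInterval.lipschitzOnWith_comp {X Y : Type*}
    [PseudoMetricSpace X] [PseudoMetricSpace Y] {f : ℝ → X} {a b : ℝ}
    (hf : AbsolutelyContinuousOnInterval f a b) {K : NNReal} {F : X → Y} {s : Set X}
    (hF : LipschitzOnWith K F s) (hs : MapsTo f (uIcc a b) s) :
    AbsolutelyContinuousOnInterval (fun t ↦ F (f t)) a b := by
  rw [absolutelyContinuousOnInterval_iff] at hf ⊢
  intro ε hε
  obtain ⟨δ, hδ, h⟩ := hf (ε / (K + 1)) (by positivity)
  refine ⟨δ, hδ, fun I hI hlen ↦ ?_⟩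
  have h1 := h I hI hlen
  rw [lt_div_iff₀ (by positivity)] at h1
  refine lt_of_le_of_lt ?_ h1
  rw [mul_comm, Finset.mul_sum]
  refine Finset.sum_le_sum fun i hi ↦ ?_
  refine (hF.dist_le_mul _ (hs (hI.1 i hi).1) _ (hs (hI.1 i hi).2)).trans ?_
  gcongr
  simp

theorem _root_.AbsolutelyContinuousOnInterval.prodMk {X Y : Type*}
    [PseudoMetricSpace X] [PseudoMetricSpace Y] {f : ℝ → X} {g : ℝ → Y} {a b : ℝ}
    (hf : AbsolutelyContinuousOnInterval f a b) (hg : AbsolutelyContinuousOnInterval g a b) :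
    AbsolutelyContinuousOnInterval (fun t ↦ (f t, g t)) a b := by
  refine squeeze_zero (fun I ↦ Finset.sum_nonneg fun i _ ↦ dist_nonneg) (fun I ↦ ?_)
    (by simpa using Tendsto.add hf hg)
  rw [← Finset.sum_add_distrib]
  refine Finset.sum_le_sum fun i _ ↦ ?_
  rw [Prod.dist_eq]
  exact max_le (le_add_of_nonneg_right dist_nonneg) (le_add_of_nonneg_left dist_nonneg)

/-- `f` is absolutely continuous on some interval around `t`. -/
def LocallyAC {X : Type*} [PseudoMetricSpace X] (f : ℝ → X) (t : ℝ) : Prop :=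
  ∃ δ > 0, AbsolutelyContinuousOnInterval f (t - δ) (t + δ)

section LocallyAC

variable {X Y : Type*} [SeminormedAddCommGroup X] [PseudoMetricSpace Y] {f : ℝ → X} {t : ℝ}

theorem LocallyAC.continuousAt (hf : LocallyAC f t) : ContinuousAt f t := by
  obtain ⟨δ, hδ, h⟩ := hf
  have h1 : ContinuousOn f (uIcc (t - δ) (t + δ)) := h.uniformContinuousOn.continuousOn
  have h2 : uIcc (t - δ) (t + δ) ∈ 𝓝 t := by
    rw [uIcc_of_le (by linarith)]
    exact Icc_mem_nhds (by linarith) (by linarith)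
  exact h1.continuousAt h2

theorem LocallyAC.prodMk {g : ℝ → Y} (hf : LocallyAC f t) (hg : LocallyAC g t) :
    LocallyAC (fun s ↦ (f s, g s)) t := by
  obtain ⟨δ, hδ, h⟩ := hf
  obtain ⟨δ', hδ', h'⟩ := hg
  have hm : 0 < min δ δ' := lt_min hδ hδ'
  have h1 := min_le_left δ δ'
  have h2 := min_le_right δ δ'
  refine ⟨min δ δ', hm, (h.mono ?_).prodMk (h'.mono ?_)⟩ <;>
  · rw [uIcc_of_le (by linarith), uIcc_of_le (by linarith)]
    exact Icc_subset_Icc (by linarith) (by linarith)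

theorem LocallyAC.congr {g : ℝ → X} (hf : LocallyAC f t) (hfg : f =ᶠ[𝓝 t] g) : LocallyAC g t := by
  obtain ⟨δ, hδ, h⟩ := hf
  obtain ⟨η, hη, hsub⟩ := Metric.eventually_nhds_iff.1 hfg
  have hm : 0 < min δ (η / 2) := lt_min hδ (by linarith)
  have h1 := min_le_left δ (η / 2)
  have h2 := min_le_right δ (η / 2)
  refine ⟨min δ (η / 2), hm, ?_⟩
  have h3 : AbsolutelyContinuousOnInterval f (t - min δ (η / 2)) (t + min δ (η / 2)) := by
    refine h.mono ?_
    rw [uIcc_of_le (by linarith), uIcc_of_le (by linarith)]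
    exact Icc_subset_Icc (by linarith) (by linarith)
  have key : ∀ s ∈ uIcc (t - min δ (η / 2)) (t + min δ (η / 2)), f s = g s := by
    intro s hs
    rw [uIcc_of_le (by linarith)] at hs
    refine hsub ?_
    rw [Real.dist_eq, abs_lt]
    constructor <;> linarith [hs.1, hs.2]
  rw [absolutelyContinuousOnInterval_iff] at h3 ⊢
  intro ε hε
  obtain ⟨ρ, hρ, h4⟩ := h3 ε hε
  refine ⟨ρ, hρ, fun I hI hlen ↦ ?_⟩
  convert! h4 I hI hlen using 1
  refine Finset.sum_congr rfl fun i hi ↦ ?_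
  rw [key _ (hI.1 i hi).1, key _ (hI.1 i hi).2]

theorem LocallyAC.lipschitz_comp {F : X → Y} {K : NNReal} {s : Set X} (hf : LocallyAC f t)
    (hF : LipschitzOnWith K F s) (hs : s ∈ 𝓝 (f t)) : LocallyAC (fun r ↦ F (f r)) t := by
  have hev := hf.continuousAt.eventually hs
  obtain ⟨δ, hδ, h⟩ := hf
  obtain ⟨η, hη, hsub⟩ := Metric.eventually_nhds_iff.1 hev
  have hm : 0 < min δ (η / 2) := lt_min hδ (by linarith)
  have h1 := min_le_left δ (η / 2)
  have h2 := min_le_right δ (η / 2)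
  refine ⟨min δ (η / 2), hm, AbsolutelyContinuousOnInterval.lipschitzOnWith_comp (h.mono ?_) hF ?_⟩
  · rw [uIcc_of_le (by linarith), uIcc_of_le (by linarith)]
    exact Icc_subset_Icc (by linarith) (by linarith)
  · intro r hr
    rw [uIcc_of_le (by linarith)] at hr
    refine hsub ?_
    rw [Real.dist_eq, abs_lt]
    constructor <;> linarith [hr.1, hr.2]

end LocallyAC

section Normed

variable {V W : Type*} [NormedAddCommGroup V] [NormedSpace ℝ V] [NormedAddCommGroup W]
  [NormedSpace ℝ W]

theorem LocallyAC.contDiffAt_comp {f : ℝ → V} {t : ℝ} (hf : LocallyAC f t) {F : V → W}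
    (hF : ContDiffAt ℝ 1 F (f t)) : LocallyAC (fun r ↦ F (f r)) t := by
  obtain ⟨K, s, hs, hK⟩ := hF.exists_lipschitzOnWith
  exact hf.lipschitz_comp hK hs

/-- A norming functional of the increment reduces the bound to a real-valued function, for which the
fundamental theorem of calculus applies. -/
theorem _root_.AbsolutelyContinuousOnInterval.norm_sub_le_of_ae_hasDerivAt {f : ℝ → V} {a b K : ℝ}
    (hf : AbsolutelyContinuousOnInterval f a b) (hab : a ≤ b)
    (hd : ∀ᵐ t : ℝ, t ∈ Icc a b → ∃ f', HasDerivAt f f' t ∧ ‖f'‖ ≤ K) :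
    ‖f b - f a‖ ≤ K * (b - a) := by
  obtain ⟨m, hm, hm'⟩ := exists_dual_vector'' ℝ (f b - f a)
  have hmf : AbsolutelyContinuousOnInterval (fun t ↦ m (f t)) a b :=
    hf.lipschitzOnWith_comp (s := univ) (m.lipschitz.lipschitzOnWith) (mapsTo_univ _ _)
  have hint := hmf.integral_deriv_eq_sub
  have h1 : ‖∫ t in a..b, deriv (fun t ↦ m (f t)) t‖ ≤ K * |b - a| := by
    refine intervalIntegral.norm_integral_le_of_norm_le_const_ae ?_
    filter_upwards [hd] with t ht hmem
    rw [uIoc_of_le hab] at hmem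
    obtain ⟨f', hf', hK⟩ := ht (Ioc_subset_Icc_self hmem)
    have h2 : HasDerivAt (fun t ↦ m (f t)) (m f') t := m.hasFDerivAt.comp_hasDerivAt t hf'
    rw [h2.deriv]
    calc ‖m f'‖ ≤ ‖m‖ * ‖f'‖ := m.le_opNorm _
      _ ≤ 1 * ‖f'‖ := by gcongr
      _ ≤ K := by simpa using hK
  rw [hint, ← map_sub, hm', abs_of_nonneg (by linarith)] at h1
  simpa using h1

/-- Continuous induction on the right endpoint: the good endpoints form a closed set, and local
absolute continuity pushes each of them a little further. -/
theorem norm_sub_le_of_locallyAC {f : ℝ → V} {a b K : ℝ} (hab : a ≤ b)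
    (hf : ∀ t ∈ Icc a b, LocallyAC f t)
    (hd : ∀ᵐ t : ℝ, t ∈ Icc a b → ∃ f', HasDerivAt f f' t ∧ ‖f'‖ ≤ K) :
    ‖f b - f a‖ ≤ K * (b - a) := by
  have hcont : ContinuousOn f (Icc a b) := fun t ht ↦ (hf t ht).continuousAt.continuousWithinAt
  have hsub : Icc a b ⊆ {c | ‖f c - f a‖ ≤ K * (c - a)} := by
    refine IsClosed.Icc_subset_of_forall_exists_gt ?_ (by simp) ?_
    · have : {c | ‖f c - f a‖ ≤ K * (c - a)} ∩ Icc a b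
          = {c ∈ Icc a b | ‖f c - f a‖ ≤ K * (c - a)} := by
        ext c; simp [and_comm]
      rw [this]
      exact isClosed_Icc.isClosed_le (by fun_prop) (by fun_prop)
    · rintro c ⟨hc, hcab⟩ d hd'
      obtain ⟨δ, hδ, hac⟩ := hf c ⟨hcab.1, hcab.2.le⟩
      have hd1 : c < d := hd'
      have hcb := hcab.2
      refine ⟨min (min d b) (c + δ), ?_, ⟨?_, ?_⟩⟩
      · set e := min (min d b) (c + δ) with he
        have hce : c ≤ e := le_min (le_min hd1.le hcb.le) (by linarith)
        have heb : e ≤ b := (min_le_left _ _).trans (min_le_right _ _)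
        have heδ : e ≤ c + δ := min_le_right _ _
        have h1 : ‖f e - f c‖ ≤ K * (e - c) := by
          refine AbsolutelyContinuousOnInterval.norm_sub_le_of_ae_hasDerivAt (hac.mono ?_) hce ?_
          · rw [uIcc_of_le hce, uIcc_of_le (by linarith)]
            exact Icc_subset_Icc (by linarith) heδ
          · filter_upwards [hd] with t ht hmem
            exact ht ⟨hcab.1.trans hmem.1, hmem.2.trans heb⟩
        have h2 : ‖f c - f a‖ ≤ K * (c - a) := hc
        have h3 : ‖f e - f a‖ ≤ ‖f e - f c‖ + ‖f c - f a‖ := by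
          simpa using norm_add_le (f e - f c) (f c - f a)
        change ‖f e - f a‖ ≤ K * (e - a)
        linarith
      · exact lt_min (lt_min hd1 hcb) (by linarith)
      · exact (min_le_left _ _).trans (min_le_left _ _)
  exact hsub ⟨hab, le_rfl⟩

/-- The case `K = 0` of the mean value bound. Both conservation laws, for the space momentum and for
the maximal Hamiltonian, are instances. -/
theorem eq_of_locallyAC_of_ae_hasDerivAt_zero {f : ℝ → V} (hf : ∀ t, LocallyAC f t)
    (hd : ∀ᵐ t : ℝ, HasDerivAt f 0 t) (s t : ℝ) : f s = f t := by
  wlog hst : s ≤ t generalizing s t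
  · exact (this t s (le_of_not_ge hst)).symm
  have := norm_sub_le_of_locallyAC (K := 0) hst (fun r _ ↦ hf r)
    (by filter_upwards [hd] with r hr _ using ⟨0, hr, by simp⟩)
  rw [zero_mul, norm_le_zero_iff, sub_eq_zero] at this
  exact this.symm

end Normed

/-! ### Null sets of times: localization and self-intersections. -/

theorem ae_of_forall_eventually {p : ℝ → Prop}
    (h : ∀ t : ℝ, ∃ u ∈ 𝓝 t, ∀ᵐ s : ℝ, s ∈ u → p s) : ∀ᵐ s : ℝ, p s := by
  rw [ae_iff]
  refine measure_null_of_locally_null _ fun t _ ↦ ?_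
  obtain ⟨u, hu, hp⟩ := h t
  refine ⟨u ∩ {a | ¬ p a}, inter_mem (mem_nhdsWithin_of_mem_nhds hu) self_mem_nhdsWithin, ?_⟩
  rw [ae_iff] at hp
  convert! hp using 2
  ext s; simp

/-- The transverse self-intersection parameters of a curve form a countable set: a pair `(s, t)`
such that `f s = f t` is isolated among all such pairs if the velocities at `s` and `t`, read in a
suitable coordinate system, are linearly independent. -/
theorem countable_transverse_selfIntersections {X V : Type*} [NormedAddCommGroup V]
    [NormedSpace ℝ V] {g : ℝ → X} {S : Set (ℝ × ℝ)}
    (hS : ∀ p ∈ S, g p.1 = g p.2 ∧ ∃ (φ : X → V) (v w : V),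
      HasDerivAt (fun t ↦ φ (g t)) v p.1 ∧ HasDerivAt (fun t ↦ φ (g t)) w p.2 ∧
      ∀ a b : ℝ, a • v = b • w → a = 0 ∧ b = 0) : S.Countable := by
  -- Every subset of the plane is Lindelöf, so it is enough that `S` is discrete.
  refine IsLindelof.countable (HereditarilyLindelofSpace.isLindelof S) ?_
  rw [discreteTopology_subtype_iff]
  intro p hp
  obtain ⟨hg, φ, v, w, hv, hw, hind⟩ := hS p hp
  have h1 : HasFDerivAt (fun q : ℝ × ℝ ↦ φ (g q.1) - φ (g q.2))
      (((1 : ℝ →L[ℝ] ℝ).smulRight v).comp (ContinuousLinearMap.fst ℝ ℝ ℝ) -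
        ((1 : ℝ →L[ℝ] ℝ).smulRight w).comp (ContinuousLinearMap.snd ℝ ℝ ℝ)) p := by
    refine HasFDerivAt.sub ?_ ?_
    · exact HasFDerivAt.comp (g := fun t ↦ φ (g t)) p hv.hasFDerivAt hasFDerivAt_fst
    · exact HasFDerivAt.comp (g := fun t ↦ φ (g t)) p hw.hasFDerivAt hasFDerivAt_snd
  have h2 := h1.eventually_ne (c := 0) ?_
  · rw [← disjoint_iff, disjoint_principal_right]
    filter_upwards [h2] with q hq hqS
    exact hq (by rw [(hS q hqS).1, sub_self])
  -- Independence of the velocities makes the derivative `(a, b) ↦ a • v - b • w` injective, hence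
  -- bounded below because its domain is finite-dimensional.
  · obtain ⟨K, -, hK⟩ := LinearMap.exists_antilipschitzWith
      ((((1 : ℝ →L[ℝ] ℝ).smulRight v).comp (ContinuousLinearMap.fst ℝ ℝ ℝ) -
        ((1 : ℝ →L[ℝ] ℝ).smulRight w).comp (ContinuousLinearMap.snd ℝ ℝ ℝ) :
          ℝ × ℝ →L[ℝ] V) : ℝ × ℝ →ₗ[ℝ] V) (by
        rw [LinearMap.ker_eq_bot']
        rintro ⟨a, b⟩ hab
        have : a • v = b • w := by simpa [sub_eq_zero] using hab
        obtain ⟨rfl, rfl⟩ := hind a b this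
        rfl)
    exact ⟨K, hK⟩

/-! ### Left- and right-invariant vector fields in a chart -/

section Calculus

variable {E : Type*} [NormedAddCommGroup E] [NormedSpace ℝ E]

/-- The vector fields obtained by differentiating `F(a, y, b)` in `b`, respectively in `a`, at the
unit `e` commute, if `F` describes two commuting local actions. -/
theorem fderiv_comm_of_two_sided_action {F : E × E × E → E} {e y : E}
    (hF : ContDiffAt ℝ 2 F (e, y, e)) (hy : F (e, y, e) = y) (u ξ : E)
    (hl : ∀ᶠ a in 𝓝 e, fderiv ℝ F (e, F (a, y, e), e) (0, 0, u) = fderiv ℝ F (a, y, e) (0, 0, u))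
    (hr : ∀ᶠ b in 𝓝 e, fderiv ℝ F (e, F (e, y, b), e) (ξ, 0, 0) = fderiv ℝ F (e, y, b) (ξ, 0, 0)) :
    fderiv ℝ (fun z ↦ fderiv ℝ F (e, z, e) (0, 0, u)) y (fderiv ℝ F (e, y, e) (ξ, 0, 0)) =
      fderiv ℝ (fun z ↦ fderiv ℝ F (e, z, e) (ξ, 0, 0)) y (fderiv ℝ F (e, y, e) (0, 0, u)) := by
  have hsymm : IsSymmSndFDerivAt ℝ F (e, y, e) := hF.isSymmSndFDerivAt (by simp)
  have hF1 : HasFDerivAt F (fderiv ℝ F (e, y, e)) (e, y, e) :=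
    (hF.differentiableAt (by norm_num)).hasFDerivAt
  have hD : HasFDerivAt (fderiv ℝ F) (fderiv ℝ (fderiv ℝ F) (e, y, e)) (e, y, e) :=
    ((hF.fderiv_right (m := 1) (by norm_num)).differentiableAt (by norm_num)).hasFDerivAt
  have hDv : ∀ v : E × E × E, HasFDerivAt (fun p ↦ fderiv ℝ F p v)
      ((ContinuousLinearMap.apply ℝ E v).comp (fderiv ℝ (fderiv ℝ F) (e, y, e))) (e, y, e) :=
    fun v ↦ (ContinuousLinearMap.apply ℝ E v).hasFDerivAt.comp (e, y, e) hD
  have hmid : ∀ v : E × E × E, DifferentiableAt ℝ (fun z ↦ fderiv ℝ F (e, z, e) v) y := by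
    intro v
    have h1 : DifferentiableAt ℝ (fun z : E ↦ ((e, z, e) : E × E × E)) y := by fun_prop
    exact DifferentiableAt.comp (g := fun p ↦ fderiv ℝ F p v) y (hDv v).differentiableAt h1
  have ha : HasFDerivAt (fun a : E ↦ ((a, y, e) : E × E × E))
      (ContinuousLinearMap.inl ℝ E (E × E)) e := hasFDerivAt_prodMk_left e (y, e)
  have hb : HasFDerivAt (fun b : E ↦ ((e, y, b) : E × E × E))
      ((ContinuousLinearMap.inr ℝ E (E × E)).comp (ContinuousLinearMap.inr ℝ E E)) e :=
    (hasFDerivAt_prodMk_right e (y, e)).comp e (hasFDerivAt_prodMk_right y e)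
  have ha1 := HasFDerivAt.comp e hF1 ha
  have hb1 := HasFDerivAt.comp e hF1 hb
  have ha2 := HasFDerivAt.comp e (hDv (0, 0, u)) ha
  have hb2 := HasFDerivAt.comp e (hDv (ξ, 0, 0)) hb
  have hm1 : HasFDerivAt (fun z ↦ fderiv ℝ F (e, z, e) (0, 0, u))
      (fderiv ℝ (fun z ↦ fderiv ℝ F (e, z, e) (0, 0, u)) y) (F (e, y, e)) := by
    rw [hy]; exact (hmid _).hasFDerivAt
  have hm2 : HasFDerivAt (fun z ↦ fderiv ℝ F (e, z, e) (ξ, 0, 0))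
      (fderiv ℝ (fun z ↦ fderiv ℝ F (e, z, e) (ξ, 0, 0)) y) (F (e, y, e)) := by
    rw [hy]; exact (hmid _).hasFDerivAt
  have ha3 := HasFDerivAt.comp (f := fun a ↦ F (a, y, e)) e hm1 ha1
  have hb3 := HasFDerivAt.comp (f := fun b ↦ F (e, y, b)) e hm2 hb1
  -- Differentiating `hl` in `a` and `hr` in `b` expresses each side of the goal as a mixed second
  -- derivative of `F` at `(e, y, e)`, in the two possible orders.
  have ea := (ha2.congr_of_eventuallyEq hl).unique ha3
  have eb := (hb2.congr_of_eventuallyEq hr).unique hb3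
  have ea' := congrArg (fun L : E →L[ℝ] E ↦ L ξ) ea
  have eb' := congrArg (fun L : E →L[ℝ] E ↦ L u) eb
  simp only [ContinuousLinearMap.comp_apply, ContinuousLinearMap.inl_apply,
    ContinuousLinearMap.inr_apply, ContinuousLinearMap.apply_apply] at ea' eb'
  rw [Prod.mk_zero_zero] at *
  rw [← ea', ← eb']
  exact hsymm _ _

end Calculus

section Charts

variable {E : Type*} [NormedAddCommGroup E] [NormedSpace ℝ E]
  {G : Type*} [TopologicalSpace G] [ChartedSpace E G] [Group G]

/-- The map `(a, g, b) ↦ a g b` in the chart around the unit (for `a`, `b`) and around `x₀`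
(for `g` and the product). -/
def chartMul (x₀ : G) (p : E × E × E) : E :=
  extChartAt 𝓘(ℝ, E) x₀ ((extChartAt 𝓘(ℝ, E) (1 : G)).symm p.1 *
    (extChartAt 𝓘(ℝ, E) x₀).symm p.2.1 * (extChartAt 𝓘(ℝ, E) (1 : G)).symm p.2.2)

variable (E G) in
/-- The coordinates of the unit. -/
def unitCoord : E := extChartAt 𝓘(ℝ, E) (1 : G) 1

/-- The left-invariant vector fields in the chart around `x₀`. -/
def leftCoord (x₀ : G) (y : E) : E →L[ℝ] E :=
  (fderiv ℝ (chartMul x₀) (unitCoord E G, y, unitCoord E G)).comp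
    ((ContinuousLinearMap.inr ℝ E (E × E)).comp (ContinuousLinearMap.inr ℝ E E))

/-- The right-invariant vector fields in the chart around `x₀`. -/
def rightCoord (x₀ : G) (y : E) : E →L[ℝ] E :=
  (fderiv ℝ (chartMul x₀) (unitCoord E G, y, unitCoord E G)).comp
    (ContinuousLinearMap.inl ℝ E (E × E))

/-- The right-invariant vector field `dr_h(ξ)`. -/
def rightInvariantField (ξ : GroupLieAlgebra 𝓘(ℝ, E) G) (h : G) : TangentSpace 𝓘(ℝ, E) h :=
  mfderiv 𝓘(ℝ, E) 𝓘(ℝ, E) (fun x : G ↦ x * h) (1 : G) ξ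

@[simp]
theorem unitCoord_symm : (extChartAt 𝓘(ℝ, E) (1 : G)).symm (unitCoord E G) = 1 :=
  extChartAt_to_inv (1 : G)

theorem unitCoord_mem_target : unitCoord E G ∈ (extChartAt 𝓘(ℝ, E) (1 : G)).target :=
  mem_extChartAt_target (1 : G)

theorem chartMul_unit (x₀ : G) {y : E} (hy : y ∈ (extChartAt 𝓘(ℝ, E) x₀).target) :
    chartMul x₀ (unitCoord E G, y, unitCoord E G) = y := by
  simp only [chartMul, unitCoord_symm, one_mul, mul_one, (extChartAt 𝓘(ℝ, E) x₀).right_inv hy]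

section LieGroup

variable [LieGroup 𝓘(ℝ, E) ∞ G]

theorem contDiffAt_chartMul (x₀ : G) {p : E × E × E}
    (h1 : p.1 ∈ (extChartAt 𝓘(ℝ, E) (1 : G)).target)
    (h2 : p.2.1 ∈ (extChartAt 𝓘(ℝ, E) x₀).target)
    (h3 : p.2.2 ∈ (extChartAt 𝓘(ℝ, E) (1 : G)).target)
    (h4 : (extChartAt 𝓘(ℝ, E) (1 : G)).symm p.1 * (extChartAt 𝓘(ℝ, E) x₀).symm p.2.1 *
      (extChartAt 𝓘(ℝ, E) (1 : G)).symm p.2.2 ∈ (extChartAt 𝓘(ℝ, E) x₀).source) :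
    ContDiffAt ℝ ∞ (chartMul x₀) p := by
  rw [← contMDiffAt_iff_contDiffAt]
  have hs : ∀ (x : G) (y : E), y ∈ (extChartAt 𝓘(ℝ, E) x).target →
      ContMDiffAt 𝓘(ℝ, E) 𝓘(ℝ, E) ∞ (extChartAt 𝓘(ℝ, E) x).symm y := fun x y hy ↦
    (contMDiffOn_extChartAt_symm x).contMDiffAt ((isOpen_extChartAt_target x).mem_nhds hy)
  have hφ : ContMDiffAt 𝓘(ℝ, E) 𝓘(ℝ, E) ∞ (extChartAt 𝓘(ℝ, E) x₀) _ :=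
    contMDiffAt_extChartAt' (by rwa [extChartAt_source] at h4)
  have e1 : ContMDiffAt 𝓘(ℝ, E × E × E) 𝓘(ℝ, E) ∞ (fun p : E × E × E ↦ p.1) p :=
    contDiff_fst.contMDiff.contMDiffAt
  have e2 : ContMDiffAt 𝓘(ℝ, E × E × E) 𝓘(ℝ, E) ∞ (fun p : E × E × E ↦ p.2.1) p :=
    (contDiff_fst.comp contDiff_snd).contMDiff.contMDiffAt
  have e3 : ContMDiffAt 𝓘(ℝ, E × E × E) 𝓘(ℝ, E) ∞ (fun p : E × E × E ↦ p.2.2) p :=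
    (contDiff_snd.comp contDiff_snd).contMDiff.contMDiffAt
  have m1 := (hs 1 _ h1).comp p e1
  have m2 := (hs x₀ _ h2).comp p e2
  have m3 := (hs 1 _ h3).comp p e3
  exact ContMDiffAt.comp (g := extChartAt 𝓘(ℝ, E) x₀) p hφ ((m1.mul m2).mul m3)

theorem contDiffAt_chartMul_unit (x₀ : G) {y : E} (hy : y ∈ (extChartAt 𝓘(ℝ, E) x₀).target) :
    ContDiffAt ℝ ∞ (chartMul x₀) (unitCoord E G, y, unitCoord E G) := by
  refine contDiffAt_chartMul x₀ unitCoord_mem_target hy unitCoord_mem_target ?_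
  rw [unitCoord_symm, one_mul, mul_one]
  exact (extChartAt 𝓘(ℝ, E) x₀).map_target hy

theorem hasMFDerivAt_extChartAt {x₀ h : G} (hh : h ∈ (extChartAt 𝓘(ℝ, E) x₀).source) :
    HasMFDerivAt 𝓘(ℝ, E) 𝓘(ℝ, E) (extChartAt 𝓘(ℝ, E) x₀) h
      (mfderiv 𝓘(ℝ, E) 𝓘(ℝ, E) (extChartAt 𝓘(ℝ, E) x₀) h) := by
  have : IsManifold 𝓘(ℝ, E) 1 G := .of_le (n := ∞) (by simp)
  exact (mdifferentiableAt_extChartAt (by rwa [extChartAt_source] at hh)).hasMFDerivAt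

theorem hasMFDerivAt_extChartAt_symm {x₀ : G} {y : E}
    (hy : y ∈ (extChartAt 𝓘(ℝ, E) x₀).target) :
    HasMFDerivAt 𝓘(ℝ, E) 𝓘(ℝ, E) (extChartAt 𝓘(ℝ, E) x₀).symm y
      (mfderiv 𝓘(ℝ, E) 𝓘(ℝ, E) (extChartAt 𝓘(ℝ, E) x₀).symm y) := by
  have : IsManifold 𝓘(ℝ, E) 1 G := .of_le (n := ∞) (by simp)
  have := mdifferentiableWithinAt_extChartAt_symm (I := 𝓘(ℝ, E)) hy
  rw [modelWithCornersSelf_coe, range_id, mdifferentiableWithinAt_univ] at this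
  exact this.hasMFDerivAt

/-- The tangent space at a point is identified with `E` through the preferred chart at that point,
so no coordinate change appears at the unit. -/
theorem hasMFDerivAt_extChartAt_symm_unit :
    HasMFDerivAt 𝓘(ℝ, E) 𝓘(ℝ, E) (extChartAt 𝓘(ℝ, E) (1 : G)).symm (unitCoord E G)
      (ContinuousLinearMap.id ℝ E) := by
  have : IsManifold 𝓘(ℝ, E) 1 G := .of_le (n := ∞) (by simp)
  have h1 := hasMFDerivAt_extChartAt_symm (E := E) (unitCoord_mem_target (E := E) (G := G))
  have h2 := mfderivWithin_range_extChartAt_symm (I := 𝓘(ℝ, E)) (x := (1 : G))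
  rw [modelWithCornersSelf_coe, range_id, mfderivWithin_univ] at h2
  exact h2 ▸ h1

theorem hasMFDerivAt_mul_left (g h : G) :
    HasMFDerivAt 𝓘(ℝ, E) 𝓘(ℝ, E) (fun x : G ↦ g * x) h
      (mfderiv 𝓘(ℝ, E) 𝓘(ℝ, E) (fun x : G ↦ g * x) h) :=
  ((contMDiff_mul_left (I := 𝓘(ℝ, E)) (n := ∞) (a := g)).mdifferentiableAt
    (by simp)).hasMFDerivAt

theorem hasMFDerivAt_mul_right (g h : G) :
    HasMFDerivAt 𝓘(ℝ, E) 𝓘(ℝ, E) (fun x : G ↦ x * g) h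
      (mfderiv 𝓘(ℝ, E) 𝓘(ℝ, E) (fun x : G ↦ x * g) h) :=
  ((contMDiff_mul_right (I := 𝓘(ℝ, E)) (n := ∞) (a := g)).mdifferentiableAt
    (by simp)).hasMFDerivAt

/-- Chain rule with the base point given by an equation and derivatives typed on the model spaces;
this avoids transport between tangent spaces at points such as `h * 1` and `h`. -/
theorem hasMFDerivAt_comp_of_eq {E₁ E₂ E₃ M₁ M₂ M₃ : Type*}
    [NormedAddCommGroup E₁] [NormedSpace ℝ E₁] [NormedAddCommGroup E₂] [NormedSpace ℝ E₂]
    [NormedAddCommGroup E₃] [NormedSpace ℝ E₃]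
    [TopologicalSpace M₁] [ChartedSpace E₁ M₁] [TopologicalSpace M₂] [ChartedSpace E₂ M₂]
    [TopologicalSpace M₃] [ChartedSpace E₃ M₃] {f : M₁ → M₂} {g : M₂ → M₃} {x : M₁} {y : M₂}
    {f' : E₁ →L[ℝ] E₂} {g' : E₂ →L[ℝ] E₃} (hg : HasMFDerivAt 𝓘(ℝ, E₂) 𝓘(ℝ, E₃) g y g')
    (hf : HasMFDerivAt 𝓘(ℝ, E₁) 𝓘(ℝ, E₂) f x f') (hy : f x = y) :
    HasMFDerivAt 𝓘(ℝ, E₁) 𝓘(ℝ, E₃) (g ∘ f) x (g'.comp f') := by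
  subst hy
  exact HasMFDerivAt.comp x hg hf

/-- With the first two arguments of `chartMul` frozen, what remains is the chart after left
translation by `h` after the inverse chart at the unit. -/
theorem leftCoord_apply {x₀ h : G} (hh : h ∈ (extChartAt 𝓘(ℝ, E) x₀).source)
    (u : GroupLieAlgebra 𝓘(ℝ, E) G) :
    leftCoord x₀ (extChartAt 𝓘(ℝ, E) x₀ h) u =
      mfderiv 𝓘(ℝ, E) 𝓘(ℝ, E) (extChartAt 𝓘(ℝ, E) x₀) h (mulInvariantVectorField u h) := by
  have hy := (extChartAt 𝓘(ℝ, E) x₀).map_source hh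
  have h1 : HasFDerivAt (fun b ↦ chartMul x₀ (unitCoord E G, extChartAt 𝓘(ℝ, E) x₀ h, b))
      (leftCoord x₀ (extChartAt 𝓘(ℝ, E) x₀ h)) (unitCoord E G) :=
    HasFDerivAt.comp (g := chartMul x₀)
      (f := fun b ↦ (unitCoord E G, extChartAt 𝓘(ℝ, E) x₀ h, b)) (unitCoord E G)
      ((contDiffAt_chartMul_unit x₀ hy).differentiableAt (by simp)).hasFDerivAt
      ((hasFDerivAt_prodMk_right _ _).comp _ (hasFDerivAt_prodMk_right _ _))
  have h2 : (fun b ↦ chartMul x₀ (unitCoord E G, extChartAt 𝓘(ℝ, E) x₀ h, b)) =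
      extChartAt 𝓘(ℝ, E) x₀ ∘ ((fun x : G ↦ h * x) ∘ (extChartAt 𝓘(ℝ, E) (1 : G)).symm) := by
    ext b
    simp only [chartMul, (extChartAt 𝓘(ℝ, E) x₀).left_inv hh, unitCoord_symm, one_mul,
      Function.comp_apply]
  rw [h2] at h1
  have m1 := hasMFDerivAt_comp_of_eq (hasMFDerivAt_mul_left h (1 : G))
    (hasMFDerivAt_extChartAt_symm_unit (E := E)) unitCoord_symm
  have m2 := hasMFDerivAt_comp_of_eq (hasMFDerivAt_extChartAt hh) m1
    (by rw [Function.comp_apply, unitCoord_symm, mul_one])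
  rw [h1.unique m2.hasFDerivAt]
  rfl

theorem rightCoord_apply {x₀ h : G} (hh : h ∈ (extChartAt 𝓘(ℝ, E) x₀).source)
    (ξ : GroupLieAlgebra 𝓘(ℝ, E) G) :
    rightCoord x₀ (extChartAt 𝓘(ℝ, E) x₀ h) ξ =
      mfderiv 𝓘(ℝ, E) 𝓘(ℝ, E) (extChartAt 𝓘(ℝ, E) x₀) h (rightInvariantField ξ h) := by
  have hy := (extChartAt 𝓘(ℝ, E) x₀).map_source hh
  have h1 : HasFDerivAt (fun a ↦ chartMul x₀ (a, extChartAt 𝓘(ℝ, E) x₀ h, unitCoord E G))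
      (rightCoord x₀ (extChartAt 𝓘(ℝ, E) x₀ h)) (unitCoord E G) :=
    HasFDerivAt.comp (g := chartMul x₀)
      (f := fun a ↦ (a, extChartAt 𝓘(ℝ, E) x₀ h, unitCoord E G)) (unitCoord E G)
      ((contDiffAt_chartMul_unit x₀ hy).differentiableAt (by simp)).hasFDerivAt
      (hasFDerivAt_prodMk_left _ _)
  have h2 : (fun a ↦ chartMul x₀ (a, extChartAt 𝓘(ℝ, E) x₀ h, unitCoord E G)) =
      extChartAt 𝓘(ℝ, E) x₀ ∘ ((fun x : G ↦ x * h) ∘ (extChartAt 𝓘(ℝ, E) (1 : G)).symm) := by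
    ext b
    simp only [chartMul, (extChartAt 𝓘(ℝ, E) x₀).left_inv hh, unitCoord_symm, mul_one,
      Function.comp_apply]
  rw [h2] at h1
  have m1 := hasMFDerivAt_comp_of_eq (hasMFDerivAt_mul_right h (1 : G))
    (hasMFDerivAt_extChartAt_symm_unit (E := E)) unitCoord_symm
  have m2 := hasMFDerivAt_comp_of_eq (hasMFDerivAt_extChartAt hh) m1
    (by rw [Function.comp_apply, unitCoord_symm, one_mul])
  rw [h1.unique m2.hasFDerivAt]
  rfl

theorem contDiffAt_fderiv_chartMul (x₀ : G) {y : E} (hy : y ∈ (extChartAt 𝓘(ℝ, E) x₀).target) :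
    ContDiffAt ℝ ∞ (fun z ↦ fderiv ℝ (chartMul x₀) (unitCoord E G, z, unitCoord E G)) y := by
  have h1 := (contDiffAt_chartMul_unit x₀ hy).fderiv_right (m := ∞) (by simp)
  have h2 : ContDiffAt ℝ ∞ (fun z : E ↦ (unitCoord E G, z, unitCoord E G)) y := by fun_prop
  exact ContDiffAt.comp (g := fderiv ℝ (chartMul x₀)) y h1 h2

theorem contDiffAt_leftCoord (x₀ : G) {y : E} (hy : y ∈ (extChartAt 𝓘(ℝ, E) x₀).target) :
    ContDiffAt ℝ ∞ (leftCoord x₀) y :=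
  (contDiffAt_fderiv_chartMul x₀ hy).clm_comp contDiffAt_const

theorem contDiffAt_rightCoord (x₀ : G) {y : E} (hy : y ∈ (extChartAt 𝓘(ℝ, E) x₀).target) :
    ContDiffAt ℝ ∞ (rightCoord x₀) y :=
  (contDiffAt_fderiv_chartMul x₀ hy).clm_comp contDiffAt_const

/-- Left- and right-invariant vector fields commute. -/
theorem fderiv_leftCoord_rightCoord (x₀ : G) {y : E}
    (hy : y ∈ (extChartAt 𝓘(ℝ, E) x₀).target) (u ξ : E) :
    fderiv ℝ (fun z ↦ leftCoord x₀ z u) y (rightCoord x₀ y ξ) =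
      fderiv ℝ (fun z ↦ rightCoord x₀ z ξ) y (leftCoord x₀ y u) := by
  have hF := contDiffAt_chartMul_unit x₀ hy
  have hunit := unitCoord_mem_target (E := E) (G := G)
  have hcs : ContinuousAt (extChartAt 𝓘(ℝ, E) (1 : G)).symm (unitCoord E G) :=
    (hasMFDerivAt_extChartAt_symm hunit).continuousAt
  have htop : IsTopologicalGroup G := topologicalGroup_of_lieGroup 𝓘(ℝ, E) ∞
  have hsrc := (extChartAt 𝓘(ℝ, E) x₀).map_target hy
  have hopen : IsOpen (extChartAt 𝓘(ℝ, E) x₀).source := isOpen_extChartAt_source x₀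
  have htgt : ∀ᶠ a in 𝓝 (unitCoord E G), a ∈ (extChartAt 𝓘(ℝ, E) (1 : G)).target :=
    (isOpen_extChartAt_target (1 : G)).mem_nhds hunit
  have hL : ∀ᶠ a in 𝓝 (unitCoord E G), (extChartAt 𝓘(ℝ, E) (1 : G)).symm a *
      (extChartAt 𝓘(ℝ, E) x₀).symm y ∈ (extChartAt 𝓘(ℝ, E) x₀).source := by
    refine (hcs.mul continuousAt_const).eventually (hopen.mem_nhds ?_)
    rwa [Pi.mul_apply, unitCoord_symm, one_mul]
  have hR : ∀ᶠ b in 𝓝 (unitCoord E G), (extChartAt 𝓘(ℝ, E) x₀).symm y *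
      (extChartAt 𝓘(ℝ, E) (1 : G)).symm b ∈ (extChartAt 𝓘(ℝ, E) x₀).source := by
    refine (continuousAt_const.mul hcs).eventually (hopen.mem_nhds ?_)
    rwa [Pi.mul_apply, unitCoord_symm, mul_one]
  have hright : ∀ p : E × E, HasFDerivAt (fun b : E ↦ ((p.1, p.2, b) : E × E × E))
      ((ContinuousLinearMap.inr ℝ E (E × E)).comp (ContinuousLinearMap.inr ℝ E E))
      (unitCoord E G) := fun p ↦
    (hasFDerivAt_prodMk_right _ _).comp _ (hasFDerivAt_prodMk_right _ _)
  -- Both hypotheses are instances of associativity: `F(e, F(a,y,e), b) = F(a,y,b)`, differentiated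
  -- in `b`, and `F(a, F(e,y,b), e) = F(a,y,b)`, differentiated in `a`.
  refine fderiv_comm_of_two_sided_action (contDiffAt_infty.1 hF 2)
    (chartMul_unit x₀ hy) u ξ ?_ ?_
  · filter_upwards [htgt, hL] with a ha haL
    have hmem : chartMul x₀ (a, y, unitCoord E G) ∈ (extChartAt 𝓘(ℝ, E) x₀).target := by
      simp only [chartMul, unitCoord_symm, mul_one]
      exact (extChartAt 𝓘(ℝ, E) x₀).map_source haL
    have d1 := ((contDiffAt_chartMul_unit x₀ hmem).differentiableAt (by simp)).hasFDerivAt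
    have d2 := ((contDiffAt_chartMul x₀ (p := (a, y, unitCoord E G)) ha hy hunit
      (by simpa only [unitCoord_symm, mul_one] using haL)).differentiableAt (by simp)).hasFDerivAt
    have c1 := HasFDerivAt.comp (g := chartMul x₀) (unitCoord E G) d1
      (hright (unitCoord E G, chartMul x₀ (a, y, unitCoord E G)))
    have c2 := HasFDerivAt.comp (g := chartMul x₀) (unitCoord E G) d2 (hright (a, y))
    have heq : (chartMul x₀ ∘ fun b ↦ (unitCoord E G, chartMul x₀ (a, y, unitCoord E G), b)) =
        chartMul x₀ ∘ fun b ↦ (a, y, b) := by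
      ext b
      simp only [Function.comp_apply, chartMul, unitCoord_symm, one_mul, mul_one,
        (extChartAt 𝓘(ℝ, E) x₀).left_inv haL]
    rw [heq] at c1
    exact congrArg (fun L : E →L[ℝ] E ↦ L u) (c1.unique c2)
  · filter_upwards [htgt, hR] with b hb hbR
    have hmem : chartMul x₀ (unitCoord E G, y, b) ∈ (extChartAt 𝓘(ℝ, E) x₀).target := by
      simp only [chartMul, unitCoord_symm, one_mul]
      exact (extChartAt 𝓘(ℝ, E) x₀).map_source hbR
    have d1 := ((contDiffAt_chartMul_unit x₀ hmem).differentiableAt (by simp)).hasFDerivAt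
    have d2 := ((contDiffAt_chartMul x₀ (p := (unitCoord E G, y, b)) hunit hy hb
      (by simpa only [unitCoord_symm, one_mul] using hbR)).differentiableAt (by simp)).hasFDerivAt
    have c1 := HasFDerivAt.comp (g := chartMul x₀) (unitCoord E G) d1
      (hasFDerivAt_prodMk_left (𝕜 := ℝ) (unitCoord E G) (chartMul x₀ (unitCoord E G, y, b), unitCoord E G))
    have c2 := HasFDerivAt.comp (g := chartMul x₀) (unitCoord E G) d2
      (hasFDerivAt_prodMk_left (𝕜 := ℝ) (unitCoord E G) (y, b))
    have heq : (chartMul x₀ ∘ fun a ↦ (a, chartMul x₀ (unitCoord E G, y, b), unitCoord E G)) =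
        chartMul x₀ ∘ fun a ↦ (a, y, b) := by
      ext a
      simp only [Function.comp_apply, chartMul, unitCoord_symm, one_mul, mul_one,
        (extChartAt 𝓘(ℝ, E) x₀).left_inv hbR, mul_assoc]
    rw [heq] at c1
    exact congrArg (fun L : E →L[ℝ] E ↦ L ξ) (c1.unique c2)

/-! ### Translations and the adjoint representation. -/

theorem hasMFDerivAt_conj (h : G) :
    HasMFDerivAt 𝓘(ℝ, E) 𝓘(ℝ, E) (fun x : G ↦ h * x * h⁻¹) (1 : G) (Ad h : E →L[ℝ] E) :=
  (((contMDiff_mul_left (I := 𝓘(ℝ, E)) (n := ∞) (a := h)).mul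
    (contMDiff_const (c := h⁻¹))).mdifferentiableAt (by simp)).hasMFDerivAt

/-- The derivative at `x = 1` of `(h x h⁻¹) h = h x`. -/
theorem rightInvariantField_Ad (h : G) (u : GroupLieAlgebra 𝓘(ℝ, E) G) :
    rightInvariantField (Ad h u) h = mulInvariantVectorField u h := by
  have h1 := hasMFDerivAt_comp_of_eq (hasMFDerivAt_mul_right (E := E) h (1 : G))
    (hasMFDerivAt_conj h) (by simp)
  have h2 : (fun x : G ↦ x * h) ∘ (fun x : G ↦ h * x * h⁻¹) = fun x ↦ h * x := by
    ext x; simp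
  rw [h2] at h1
  exact congrArg (fun L : E →L[ℝ] E ↦ L u) (hasMFDerivAt_unique h1 (hasMFDerivAt_mul_left h 1))

theorem mfderiv_mul_left_mulInvariantVectorField (g h : G) (u : GroupLieAlgebra 𝓘(ℝ, E) G) :
    mfderiv 𝓘(ℝ, E) 𝓘(ℝ, E) (fun x : G ↦ g * x) h (mulInvariantVectorField u h) =
      (mulInvariantVectorField u (g * h) : TangentSpace 𝓘(ℝ, E) (g * h)) := by
  have h1 := hasMFDerivAt_comp_of_eq (hasMFDerivAt_mul_left (E := E) g h)
    (hasMFDerivAt_mul_left h (1 : G)) (by simp)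
  have h2 : (fun x : G ↦ g * x) ∘ (fun x : G ↦ h * x) = fun x ↦ g * h * x := by
    ext x; simp [mul_assoc]
  rw [h2] at h1
  exact congrArg (fun L : E →L[ℝ] E ↦ L u)
    (hasMFDerivAt_unique h1 (hasMFDerivAt_mul_left (g * h) 1))

theorem mulInvariantVectorField_surjective (h : G) (v : TangentSpace 𝓘(ℝ, E) h) :
    mulInvariantVectorField (mfderiv 𝓘(ℝ, E) 𝓘(ℝ, E) (fun x : G ↦ h⁻¹ * x) h v :
      E) h = v := by
  have h1 := hasMFDerivAt_comp_of_eq (hasMFDerivAt_mul_left (E := E) h (1 : G))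
    (hasMFDerivAt_mul_left h⁻¹ h) (by simp)
  have h2 : (fun x : G ↦ h * x) ∘ (fun x : G ↦ h⁻¹ * x) = id := by ext x; simp
  rw [h2] at h1
  exact congrArg (fun L : E →L[ℝ] E ↦ L v) (hasMFDerivAt_unique h1 (hasMFDerivAt_id h))

theorem mfderiv_mul_left_inv_mulInvariantVectorField (h : G) (u : GroupLieAlgebra 𝓘(ℝ, E) G) :
    (mfderiv 𝓘(ℝ, E) 𝓘(ℝ, E) (fun x : G ↦ h⁻¹ * x) h (mulInvariantVectorField u h) : E) = u := by
  have h1 := hasMFDerivAt_comp_of_eq (hasMFDerivAt_mul_left (E := E) h⁻¹ h)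
    (hasMFDerivAt_mul_left h (1 : G)) (by simp)
  have h2 : (fun x : G ↦ h⁻¹ * x) ∘ (fun x : G ↦ h * x) = id := by ext x; simp
  rw [h2] at h1
  exact congrArg (fun L : E →L[ℝ] E ↦ L u) (hasMFDerivAt_unique h1 (hasMFDerivAt_id 1))

theorem Ad_one : (Ad (1 : G) : E →L[ℝ] E) = ContinuousLinearMap.id ℝ E := by
  have h2 : (fun x : G ↦ 1 * x * 1⁻¹) = id := by ext x; simp
  have h1 := hasMFDerivAt_conj (E := E) (1 : G)
  rw [h2] at h1
  exact hasMFDerivAt_unique h1 (hasMFDerivAt_id 1)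

end LieGroup

end Charts

theorem LocallyAC.ae_differentiableAt {f : ℝ → ℝ} (hf : ∀ t, LocallyAC f t) :
    ∀ᵐ t : ℝ, DifferentiableAt ℝ f t := by
  refine ae_of_forall_eventually fun t ↦ ?_
  obtain ⟨δ, hδ, h⟩ := hf t
  refine ⟨uIcc (t - δ) (t + δ), ?_, h.ae_differentiableAt⟩
  rw [uIcc_of_le (by linarith)]
  exact Icc_mem_nhds (by linarith) (by linarith)

/-! ### Unit balls and support functions -/

section UnitBall

variable {E : Type*} [NormedAddCommGroup E] [NormedSpace ℝ E]

theorem _root_.Seminorm.continuous_of_finiteDimensional [FiniteDimensional ℝ E]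
    (F : Seminorm ℝ E) : Continuous F :=
  F.convexOn.locallyLipschitz.continuous

/-- A definite seminorm attains a positive minimum on the compact unit sphere, and `C` is its
inverse. The sphere is empty when the space is trivial, which is a separate case. -/
theorem _root_.Seminorm.exists_norm_le_mul [FiniteDimensional ℝ E] (F : Seminorm ℝ E)
    (hF : ∀ v, F v = 0 → v = 0) : ∃ C : ℝ, ∀ v, ‖v‖ ≤ C * F v := by
  rcases (Metric.sphere (0 : E) 1).eq_empty_or_nonempty with h | h
  · refine ⟨0, fun v ↦ ?_⟩
    by_contra! hv
    rw [zero_mul] at hv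
    refine eq_empty_iff_forall_notMem.1 h (‖v‖⁻¹ • v) ?_
    rw [mem_sphere_zero_iff_norm, norm_smul, norm_inv, norm_norm, inv_mul_cancel₀ hv.ne']
  · obtain ⟨m, hm, hmin⟩ := (isCompact_sphere (0 : E) 1).exists_isMinOn h
      F.continuous_of_finiteDimensional.continuousOn
    rw [mem_sphere_zero_iff_norm] at hm
    have hpos : 0 < F m := by
      refine lt_of_le_of_ne (apply_nonneg F m) fun h0 ↦ ?_
      rw [hF m h0.symm, norm_zero] at hm
      exact zero_ne_one hm
    refine ⟨(F m)⁻¹, fun v ↦ ?_⟩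
    rcases eq_or_ne v 0 with rfl | hv
    · simp
    have hv' : 0 < ‖v‖ := norm_pos_iff.2 hv
    have h1 : F m ≤ F (‖v‖⁻¹ • v) := hmin (by
      rw [mem_sphere_zero_iff_norm, norm_smul, norm_inv, norm_norm, inv_mul_cancel₀ hv'.ne'])
    rw [map_smul_eq_mul, norm_inv, norm_norm, inv_mul_eq_div, le_div_iff₀ hv'] at h1
    rwa [inv_mul_eq_div, le_div_iff₀ hpos, mul_comm]

theorem isCompact_seminorm_unitBall [FiniteDimensional ℝ E] (p : Submodule ℝ E)
    (F : Seminorm ℝ p) (hF : ∀ v, F v = 0 → v = 0) :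
    IsCompact {u : E | ∃ h : u ∈ p, F ⟨u, h⟩ ≤ 1} := by
  obtain ⟨C, hC⟩ := F.exists_norm_le_mul hF
  have h1 : IsCompact {v : p | F v ≤ 1} := by
    refine Metric.isCompact_of_isClosed_isBounded
      (isClosed_le F.continuous_of_finiteDimensional continuous_const) ?_
    refine (Metric.isBounded_closedBall (x := (0 : p)) (r := |C|)).subset fun v hv ↦ ?_
    rw [mem_closedBall_zero_iff]
    have h2 : F v ≤ 1 := hv
    calc ‖v‖ ≤ C * F v := hC v
      _ ≤ |C| * 1 := mul_le_mul (le_abs_self C) h2 (apply_nonneg F v) (abs_nonneg C)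
      _ = |C| := mul_one _
  convert! h1.image continuous_subtype_val using 1
  ext u
  simp

/-- The support function of `U`. -/
def supportFunction (U : Set E) (q : E →L[ℝ] ℝ) : ℝ := sSup (q '' U)

variable {U : Set E}

theorem apply_le_supportFunction (hU : IsCompact U) (q : E →L[ℝ] ℝ) {w : E} (hw : w ∈ U) :
    q w ≤ supportFunction U q :=
  le_csSup (hU.image q.continuous).bddAbove (mem_image_of_mem q hw)

theorem supportFunction_eq_of_isMaxOn {q : E →L[ℝ] ℝ} {w : E} (hw : w ∈ U)
    (hmax : IsMaxOn q U w) : supportFunction U q = q w := by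
  refine IsGreatest.csSup_eq ⟨mem_image_of_mem q hw, ?_⟩
  rintro _ ⟨v, hv, rfl⟩
  exact hmax hv

/-- A bound for the norm on `U` is a Lipschitz constant. Absolute continuity thereby passes from the
momentum to the maximal Hamiltonian. -/
theorem exists_lipschitzWith_supportFunction (hU : IsCompact U) (hne : U.Nonempty) :
    ∃ K, LipschitzWith K (supportFunction U) := by
  obtain ⟨R, hR⟩ := hU.isBounded.exists_norm_le
  refine ⟨R.toNNReal, LipschitzWith.of_le_add_mul _ fun q q' ↦ ?_⟩
  refine csSup_le (hne.image q) ?_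
  rintro _ ⟨w, hw, rfl⟩
  have h1 := apply_le_supportFunction hU q' hw
  have h2 : q w - q' w ≤ ‖q - q'‖ * ‖w‖ := (le_abs_self _).trans ((q - q').le_opNorm w)
  have h3 : ‖q - q'‖ * ‖w‖ ≤ ‖q - q'‖ * R.toNNReal := by
    gcongr
    exact (hR w hw).trans (Real.le_coe_toNNReal R)
  rw [dist_eq_norm, mul_comm]
  linarith

end UnitBall

section Momentum

variable {E : Type*} [NormedAddCommGroup E] [NormedSpace ℝ E]
  {G : Type*} [TopologicalSpace G] [ChartedSpace E G] [Group G]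

/-- The unit ball, as a subset of the model space `E` of the Lie algebra. -/
def LeftInvariantMetric.controlSet (D : LeftInvariantMetric E G) : Set E := D.unitBall

theorem LeftInvariantMetric.isCompact_controlSet [FiniteDimensional ℝ E]
    (D : LeftInvariantMetric E G) : IsCompact D.controlSet :=
  isCompact_seminorm_unitBall (E := E) D.p D.F D.eq_zero_of_F

theorem LeftInvariantMetric.zero_mem_controlSet (D : LeftInvariantMetric E G) :
    (0 : E) ∈ D.controlSet := by
  refine ⟨D.p.zero_mem, ?_⟩
  have : D.F 0 = 0 := map_zero D.F
  exact this.trans_le zero_le_one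

/-- A vector of the unit ball at which a linear form attains a positive maximum is a unit
vector. -/
theorem LeftInvariantMetric.F_eq_one_of_isMaxOn (D : LeftInvariantMetric E G)
    {q : E →L[ℝ] ℝ} {u : E} (hu : u ∈ D.controlSet)
    (hmax : ∀ w ∈ D.controlSet, q w ≤ q u) (hpos : 0 < q u) :
    ∃ h : u ∈ D.p, D.F ⟨u, h⟩ = 1 := by
  obtain ⟨h, h1⟩ := hu
  refine ⟨h, h1.antisymm ?_⟩
  by_contra! hlt
  have hne : D.F ⟨u, h⟩ ≠ 0 := by
    intro h0
    have hz : u = 0 := congrArg Subtype.val (D.eq_zero_of_F _ h0)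
    rw [hz, map_zero] at hpos
    exact lt_irrefl _ hpos
  have hF : 0 < D.F ⟨u, h⟩ := lt_of_le_of_ne (apply_nonneg _ _) hne.symm
  -- If `F u < 1`, rescaling `u` to a unit vector stays in the ball and strictly increases the
  -- positive value `q u`.
  have hmem : (D.F ⟨u, h⟩)⁻¹ • u ∈ D.controlSet := by
    refine ⟨D.p.smul_mem _ h, ?_⟩
    have h2 := map_smul_eq_mul D.F (D.F ⟨u, h⟩)⁻¹ ⟨u, h⟩
    rw [norm_inv, Real.norm_of_nonneg hF.le, inv_mul_cancel₀ hne] at h2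
    exact h2.le
  have h3 := hmax _ hmem
  rw [map_smul, smul_eq_mul] at h3
  have h4 : 1 < (D.F ⟨u, h⟩)⁻¹ := (one_lt_inv₀ hF).2 hlt
  nlinarith

/-! ### The Hamiltonian system in coordinates -/

section Manifold

variable {M : Type*} [TopologicalSpace M] [ChartedSpace E M] {g : ℝ → M}

theorem eventually_mem_source (hg : Continuous g) (t : ℝ) :
    ∀ᶠ s in 𝓝 t, g s ∈ (extChartAt 𝓘(ℝ, E) (g t)).source :=
  hg.continuousAt.eventually (extChartAt_source_mem_nhds (g t))

theorem IsAbsolutelyContinuousLift.locallyAC {ψ : ∀ t, TangentSpace 𝓘(ℝ, E) (g t) →L[ℝ] ℝ}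
    (h : IsAbsolutelyContinuousLift g ψ) {x₀ : M} {t : ℝ}
    (ht : g t ∈ (extChartAt 𝓘(ℝ, E) x₀).source) :
    LocallyAC (fun s ↦ extChartAt 𝓘(ℝ, E) x₀ (g s)) t ∧
      LocallyAC (fun s ↦ covectorCoord x₀ (g s) (ψ s)) t := by
  have hev : ∀ᶠ s in 𝓝 t, g s ∈ (extChartAt 𝓘(ℝ, E) x₀).source :=
    h.1.continuousAt.eventually ((isOpen_extChartAt_source x₀).mem_nhds ht)
  obtain ⟨η, hη, hsub⟩ := Metric.eventually_nhds_iff.1 hev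
  have h1 := h.2 x₀ (t - η / 2) (t + η / 2) (by linarith) fun s hs ↦ hsub (by
    rw [Real.dist_eq, abs_lt]
    constructor <;> linarith [hs.1, hs.2])
  exact ⟨⟨η / 2, by linarith, h1.1⟩, ⟨η / 2, by linarith, h1.2⟩⟩

end Manifold

/-- The momentum in body coordinates: `ψ ∘ dl_h`. -/
def bodyMomentum (h : G) (ψ : TangentSpace 𝓘(ℝ, E) h →L[ℝ] ℝ) : E →L[ℝ] ℝ :=
  ContinuousLinearMap.comp (ψ : E →L[ℝ] ℝ)
    (mfderiv 𝓘(ℝ, E) 𝓘(ℝ, E) (fun x : G ↦ h * x) (1 : G) : E →L[ℝ] E)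

/-- The momentum in space coordinates: `ψ ∘ dr_h`. -/
def spaceMomentum (h : G) (ψ : TangentSpace 𝓘(ℝ, E) h →L[ℝ] ℝ) : E →L[ℝ] ℝ :=
  ContinuousLinearMap.comp (ψ : E →L[ℝ] ℝ)
    (mfderiv 𝓘(ℝ, E) 𝓘(ℝ, E) (fun x : G ↦ x * h) (1 : G) : E →L[ℝ] E)

/-- To prove a property for almost every time, it suffices to do so in the domain of each chart. -/
theorem SatisfiesPMP.ae_of_chart {D : LeftInvariantMetric E G} {g : ℝ → G} {u : ℝ → E}
    {ψ : ∀ t, TangentSpace 𝓘(ℝ, E) (g t) →L[ℝ] ℝ} (h : SatisfiesPMP D g u ψ) {P : ℝ → Prop}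
    (hP : ∀ t x₀, g t ∈ (extChartAt 𝓘(ℝ, E) x₀).source → HamiltonianSystemAt x₀ g ψ (u t) t →
      P t) :
    ∀ᵐ t : ℝ, P t := by
  refine ae_of_forall_eventually fun t ↦ ⟨_, eventually_mem_source (E := E) h.absolutelyContinuous.1 t, ?_⟩
  filter_upwards [h.hamiltonian_system (g t)] with s hs hmem
  exact hP s _ hmem (hs hmem)

section LieGroup

variable [LieGroup 𝓘(ℝ, E) ∞ G]

theorem isInvertible_mfderiv_chart {x₀ h : G} (hh : h ∈ (extChartAt 𝓘(ℝ, E) x₀).source) :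
    (mfderiv 𝓘(ℝ, E) 𝓘(ℝ, E) (extChartAt 𝓘(ℝ, E) x₀) h).IsInvertible := by
  have : IsManifold 𝓘(ℝ, E) 1 G := .of_le (n := ∞) (by simp)
  exact isInvertible_mfderiv_extChartAt hh

theorem covectorCoord_apply_mfderiv {x₀ h : G} (hh : h ∈ (extChartAt 𝓘(ℝ, E) x₀).source)
    (ψ : TangentSpace 𝓘(ℝ, E) h →L[ℝ] ℝ) (v : TangentSpace 𝓘(ℝ, E) h) :
    covectorCoord x₀ h ψ (mfderiv 𝓘(ℝ, E) 𝓘(ℝ, E) (extChartAt 𝓘(ℝ, E) x₀) h v) = ψ v :=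
  congrArg ψ ((isInvertible_mfderiv_chart hh).inverse_apply_self v)

theorem covectorCoord_leftCoord {x₀ h : G} (hh : h ∈ (extChartAt 𝓘(ℝ, E) x₀).source)
    (ψ : TangentSpace 𝓘(ℝ, E) h →L[ℝ] ℝ) (u : GroupLieAlgebra 𝓘(ℝ, E) G) :
    covectorCoord x₀ h ψ (leftCoord x₀ (extChartAt 𝓘(ℝ, E) x₀ h) u) = hamiltonian h ψ u := by
  rw [leftCoord_apply hh]
  exact covectorCoord_apply_mfderiv hh ψ _

theorem covectorCoord_rightCoord {x₀ h : G} (hh : h ∈ (extChartAt 𝓘(ℝ, E) x₀).source)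
    (ψ : TangentSpace 𝓘(ℝ, E) h →L[ℝ] ℝ) (ξ : GroupLieAlgebra 𝓘(ℝ, E) G) :
    covectorCoord x₀ h ψ (rightCoord x₀ (extChartAt 𝓘(ℝ, E) x₀ h) ξ) =
      ψ (rightInvariantField ξ h) := by
  rw [rightCoord_apply hh]
  exact covectorCoord_apply_mfderiv hh ψ _

/-- This form, linear in `l` and smooth in `y`, makes both of Hamilton's equations explicit: `y' =
L_u(y)` and `λ' = -λ ∘ DL_u(y)`. -/
theorem chartHamiltonian_eq {x₀ : G} {y : E} (hy : y ∈ (extChartAt 𝓘(ℝ, E) x₀).target)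
    (l : E →L[ℝ] ℝ) (u : GroupLieAlgebra 𝓘(ℝ, E) G) :
    chartHamiltonian x₀ y l u = l (leftCoord x₀ y u) := by
  have h1 := leftCoord_apply ((extChartAt 𝓘(ℝ, E) x₀).map_target hy) u
  rw [(extChartAt 𝓘(ℝ, E) x₀).right_inv hy] at h1
  rw [h1]
  rfl

variable {g : ℝ → G} {u : ℝ → E}
  {ψ : ∀ t, TangentSpace 𝓘(ℝ, E) (g t) →L[ℝ] ℝ}

theorem differentiableAt_leftCoord_apply {x₀ h : G} (hh : h ∈ (extChartAt 𝓘(ℝ, E) x₀).source)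
    (v : E) : DifferentiableAt ℝ (fun y ↦ leftCoord x₀ y v) (extChartAt 𝓘(ℝ, E) x₀ h) :=
  (((contDiffAt_leftCoord x₀ ((extChartAt 𝓘(ℝ, E) x₀).map_source hh)).clm_apply
    contDiffAt_const).differentiableAt (by simp))

theorem HamiltonianSystemAt.hasDerivAt_coord {x₀ : G} {t : ℝ} {v : E}
    (h : HamiltonianSystemAt x₀ g ψ v t) (ht : g t ∈ (extChartAt 𝓘(ℝ, E) x₀).source) :
    HasDerivAt (fun s ↦ extChartAt 𝓘(ℝ, E) x₀ (g s))
      (leftCoord x₀ (extChartAt 𝓘(ℝ, E) x₀ (g t)) v) t := by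
  obtain ⟨⟨x', hx', hm⟩, -⟩ := h
  have hy := (extChartAt 𝓘(ℝ, E) x₀).map_source ht
  suffices x' = leftCoord x₀ (extChartAt 𝓘(ℝ, E) x₀ (g t)) v by rwa [← this]
  refine (SeparatingDual.eq_iff_forall_dual_eq (R := ℝ)).2 fun m ↦ ?_
  have h1 : (fun l ↦ chartHamiltonian x₀ (extChartAt 𝓘(ℝ, E) x₀ (g t)) l v) =
      ContinuousLinearMap.apply ℝ ℝ (leftCoord x₀ (extChartAt 𝓘(ℝ, E) x₀ (g t)) v) := by
    ext l
    exact chartHamiltonian_eq hy l v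
  have h2 := hm m
  rw [h1, ContinuousLinearMap.fderiv] at h2
  exact h2

theorem HamiltonianSystemAt.hasDerivAt_covectorCoord {x₀ : G} {t : ℝ}
    {v : E}
    (h : HamiltonianSystemAt x₀ g ψ v t) (ht : g t ∈ (extChartAt 𝓘(ℝ, E) x₀).source) :
    HasDerivAt (fun s ↦ covectorCoord x₀ (g s) (ψ s))
      (-(covectorCoord x₀ (g t) (ψ t)).comp
        (fderiv ℝ (fun y ↦ leftCoord x₀ y v) (extChartAt 𝓘(ℝ, E) x₀ (g t)))) t := by
  have hy := (extChartAt 𝓘(ℝ, E) x₀).map_source ht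
  have h1 : (fun x ↦ chartHamiltonian x₀ x (covectorCoord x₀ (g t) (ψ t)) v) =ᶠ[
      𝓝 (extChartAt 𝓘(ℝ, E) x₀ (g t))]
      fun x ↦ covectorCoord x₀ (g t) (ψ t) (leftCoord x₀ x v) := by
    filter_upwards [(isOpen_extChartAt_target x₀).mem_nhds hy] with x hx
    exact chartHamiltonian_eq hx _ v
  have h2 := h.2
  have h3 : HasFDerivAt (fun x ↦ covectorCoord x₀ (g t) (ψ t) (leftCoord x₀ x v)) _
      (extChartAt 𝓘(ℝ, E) x₀ (g t)) := (covectorCoord x₀ (g t) (ψ t)).hasFDerivAt.comp _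
    (differentiableAt_leftCoord_apply ht v).hasFDerivAt
  rw [h1.fderiv_eq, h3.fderiv] at h2
  exact h2

/-- Along a solution of the Hamiltonian system, the Hamiltonian with frozen control has
derivative zero. -/
theorem HamiltonianSystemAt.hasDerivAt_pairing {x₀ : G} {t : ℝ} {v : E}
    (h : HamiltonianSystemAt x₀ g ψ v t) (ht : g t ∈ (extChartAt 𝓘(ℝ, E) x₀).source)
    {Y : E → E} {Y' : E →L[ℝ] E} (hY : HasFDerivAt Y Y' (extChartAt 𝓘(ℝ, E) x₀ (g t)))
    (hcomm : fderiv ℝ (fun y ↦ leftCoord x₀ y v) (extChartAt 𝓘(ℝ, E) x₀ (g t))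
        (Y (extChartAt 𝓘(ℝ, E) x₀ (g t))) =
      Y' (leftCoord x₀ (extChartAt 𝓘(ℝ, E) x₀ (g t)) v)) :
    HasDerivAt (fun s ↦ covectorCoord x₀ (g s) (ψ s) (Y (extChartAt 𝓘(ℝ, E) x₀ (g s)))) 0 t := by
  -- The product rule gives `-λ(DL_v(Y)) + λ(Y'(L_v))`, which `hcomm` cancels.
  have h1 := (h.hasDerivAt_covectorCoord ht).clm_apply
    (hY.comp_hasDerivAt t (h.hasDerivAt_coord ht))
  refine h1.congr_deriv ?_
  rw [← hcomm]
  simp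

/-! ### Body and space momentum, and their conservation laws. -/

theorem bodyMomentum_eq_spaceMomentum_Ad (h : G) (ψ : TangentSpace 𝓘(ℝ, E) h →L[ℝ] ℝ)
    (u : GroupLieAlgebra 𝓘(ℝ, E) G) : bodyMomentum h ψ u = spaceMomentum h ψ (Ad h u) := by
  have h1 := congrArg ψ (rightInvariantField_Ad h u)
  exact h1.symm

theorem bodyMomentum_eq_covectorCoord {x₀ h : G} (hh : h ∈ (extChartAt 𝓘(ℝ, E) x₀).source)
    (ψ : TangentSpace 𝓘(ℝ, E) h →L[ℝ] ℝ) : bodyMomentum h ψ =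
      (covectorCoord x₀ h ψ).comp (leftCoord x₀ (extChartAt 𝓘(ℝ, E) x₀ h)) := by
  ext u
  exact (covectorCoord_leftCoord hh ψ u).symm

theorem spaceMomentum_eq_covectorCoord {x₀ h : G} (hh : h ∈ (extChartAt 𝓘(ℝ, E) x₀).source)
    (ψ : TangentSpace 𝓘(ℝ, E) h →L[ℝ] ℝ) : spaceMomentum h ψ =
      (covectorCoord x₀ h ψ).comp (rightCoord x₀ (extChartAt 𝓘(ℝ, E) x₀ h)) := by
  ext u
  exact (covectorCoord_rightCoord hh ψ u).symm

variable {D : LeftInvariantMetric E G}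

/-- Near each time the body momentum is a smooth function of the canonical coordinates `(y, λ)`,
which are absolutely continuous. -/
theorem SatisfiesPMP.locallyAC_bodyMomentum (h : SatisfiesPMP D g u ψ) (t : ℝ) :
    LocallyAC (fun s ↦ bodyMomentum (g s) (ψ s)) t := by
  have hsrc : g t ∈ (extChartAt 𝓘(ℝ, E) (g t)).source := mem_extChartAt_source (g t)
  obtain ⟨h1, h2⟩ := h.absolutelyContinuous.locallyAC hsrc
  have hF : ContDiffAt ℝ 1 (fun p : E × (E →L[ℝ] ℝ) ↦ p.2.comp (leftCoord (g t) p.1))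
      (extChartAt 𝓘(ℝ, E) (g t) (g t), covectorCoord (g t) (g t) (ψ t)) := by
    refine contDiffAt_snd.clm_comp (ContDiffAt.comp (g := leftCoord (g t)) _ ?_ contDiffAt_fst)
    exact contDiffAt_infty.1
      (contDiffAt_leftCoord (g t) ((extChartAt 𝓘(ℝ, E) (g t)).map_source hsrc)) 1
  refine ((h1.prodMk h2).contDiffAt_comp hF).congr ?_
  filter_upwards [eventually_mem_source (E := E) h.absolutelyContinuous.1 t] with s hs
  exact (bodyMomentum_eq_covectorCoord hs (ψ s)).symm

theorem SatisfiesPMP.locallyAC_spaceMomentum (h : SatisfiesPMP D g u ψ) (t : ℝ) :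
    LocallyAC (fun s ↦ spaceMomentum (g s) (ψ s)) t := by
  have hsrc : g t ∈ (extChartAt 𝓘(ℝ, E) (g t)).source := mem_extChartAt_source (g t)
  obtain ⟨h1, h2⟩ := h.absolutelyContinuous.locallyAC hsrc
  have hF : ContDiffAt ℝ 1 (fun p : E × (E →L[ℝ] ℝ) ↦ p.2.comp (rightCoord (g t) p.1))
      (extChartAt 𝓘(ℝ, E) (g t) (g t), covectorCoord (g t) (g t) (ψ t)) := by
    refine contDiffAt_snd.clm_comp (ContDiffAt.comp (g := rightCoord (g t)) _ ?_ contDiffAt_fst)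
    exact contDiffAt_infty.1
      (contDiffAt_rightCoord (g t) ((extChartAt 𝓘(ℝ, E) (g t)).map_source hsrc)) 1
  refine ((h1.prodMk h2).contDiffAt_comp hF).congr ?_
  filter_upwards [eventually_mem_source (E := E) h.absolutelyContinuous.1 t] with s hs
  exact (spaceMomentum_eq_covectorCoord hs (ψ s)).symm

/-- Noether's theorem: the momentum in space coordinates is constant. -/
theorem SatisfiesPMP.spaceMomentum_eq (h : SatisfiesPMP D g u ψ) (s t : ℝ) :
    spaceMomentum (g s) (ψ s) = spaceMomentum (g t) (ψ t) := by
  ext ξ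
  refine eq_of_locallyAC_of_ae_hasDerivAt_zero (f := fun s ↦ spaceMomentum (g s) (ψ s) ξ)
    (fun r ↦ (h.locallyAC_spaceMomentum r).contDiffAt_comp (F := fun q : E →L[ℝ] ℝ ↦ q ξ)
      (ContinuousLinearMap.apply ℝ ℝ ξ).contDiff.contDiffAt) ?_ s t
  refine h.ae_of_chart fun r x₀ hr hsys ↦ ?_
  have hy := (extChartAt 𝓘(ℝ, E) x₀).map_source hr
  have hY : HasFDerivAt (fun y ↦ rightCoord x₀ y ξ)
      (fderiv ℝ (fun y ↦ rightCoord x₀ y ξ) (extChartAt 𝓘(ℝ, E) x₀ (g r))) _ :=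
    (((contDiffAt_rightCoord x₀ hy).clm_apply contDiffAt_const).differentiableAt
      (by simp)).hasFDerivAt
  refine (hsys.hasDerivAt_pairing hr hY
    (fderiv_leftCoord_rightCoord x₀ hy (u r) ξ)).congr_of_eventuallyEq ?_
  filter_upwards [h.absolutelyContinuous.1.continuousAt.eventually
    ((isOpen_extChartAt_source x₀).mem_nhds hr)] with s hs
  exact (covectorCoord_rightCoord hs (ψ s) ξ).symm

/-- The field `L_{u(t)}` commutes with itself. The control is frozen at time `t` while `s` varies,
so no regularity of `u` is involved. -/
theorem SatisfiesPMP.ae_hasDerivAt_bodyMomentum (h : SatisfiesPMP D g u ψ) :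
    ∀ᵐ t : ℝ, HasDerivAt (fun s ↦ bodyMomentum (g s) (ψ s) (u t)) 0 t := by
  refine h.ae_of_chart fun r x₀ hr hsys ↦ ?_
  refine (hsys.hasDerivAt_pairing hr (differentiableAt_leftCoord_apply hr (u r)).hasFDerivAt
    rfl).congr_of_eventuallyEq ?_
  filter_upwards [h.absolutelyContinuous.1.continuousAt.eventually
    ((isOpen_extChartAt_source x₀).mem_nhds hr)] with s hs
  exact (covectorCoord_leftCoord hs (ψ s) (u r)).symm

/-- The maximal value of the Hamiltonian is constant along the curve. -/
theorem SatisfiesPMP.supportFunction_bodyMomentum_eq [FiniteDimensional ℝ E]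
    (h : SatisfiesPMP D g u ψ) (s t : ℝ) :
    supportFunction D.controlSet (bodyMomentum (g s) (ψ s)) =
      supportFunction D.controlSet (bodyMomentum (g t) (ψ t)) := by
  have hU := D.isCompact_controlSet
  obtain ⟨K, hK⟩ := exists_lipschitzWith_supportFunction hU ⟨0, D.zero_mem_controlSet⟩
  have hAC : ∀ t, LocallyAC (fun s ↦ supportFunction D.controlSet
      (bodyMomentum (g s) (ψ s))) t := fun t ↦
    (h.locallyAC_bodyMomentum t).lipschitz_comp (s := univ) hK.lipschitzOnWith univ_mem
  refine eq_of_locallyAC_of_ae_hasDerivAt_zero hAC ?_ s t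
  filter_upwards [LocallyAC.ae_differentiableAt hAC, h.ae_hasDerivAt_bodyMomentum, h.maximum]
    with r hr hd hmax
  have h1 := hr.hasDerivAt.sub hd
  -- The control is only measurable, so the maximum cannot be differentiated through `u`. Instead,
  -- its excess over the Hamiltonian with control frozen at `u r` is nonnegative and vanishes at
  -- `r`.
  have hmin : IsLocalMin ((fun s ↦ supportFunction D.controlSet
      (bodyMomentum (g s) (ψ s))) - fun s ↦ bodyMomentum (g s) (ψ s) (u r)) r := by
    refine Eventually.of_forall fun s ↦ ?_
    have h2 : supportFunction D.controlSet (bodyMomentum (g r) (ψ r)) =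
        bodyMomentum (g r) (ψ r) (u r) := supportFunction_eq_of_isMaxOn (h.control_mem r) hmax
    simp only [Pi.sub_apply, h2, sub_self, sub_nonneg]
    exact apply_le_supportFunction hU _ (h.control_mem r)
  have h3 := hmin.hasDerivAt_eq_zero h1
  rw [sub_zero] at h3
  rw [← h3]
  exact hr.hasDerivAt

theorem SatisfiesPMP.ae_hasMFDerivAt (h : SatisfiesPMP D g u ψ) :
    ∀ᵐ t : ℝ, HasMFDerivAt 𝓘(ℝ, ℝ) 𝓘(ℝ, E) g t
      ((1 : ℝ →L[ℝ] ℝ).smulRight (mulInvariantVectorField (I := 𝓘(ℝ, E)) (u t) (g t) : E)) := by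
  refine h.ae_of_chart fun r x₀ hr hsys ↦ ?_
  have hy := (extChartAt 𝓘(ℝ, E) x₀).map_source hr
  have h1 := hasMFDerivAt_comp_of_eq (hasMFDerivAt_extChartAt_symm hy)
    (hsys.hasDerivAt_coord hr).hasFDerivAt.hasMFDerivAt rfl
  have h2 : (extChartAt 𝓘(ℝ, E) x₀).symm ∘ (fun s ↦ extChartAt 𝓘(ℝ, E) x₀ (g s)) =ᶠ[𝓝 r] g := by
    filter_upwards [h.absolutelyContinuous.1.continuousAt.eventually
      ((isOpen_extChartAt_source x₀).mem_nhds hr)] with s hs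
    exact (extChartAt 𝓘(ℝ, E) x₀).left_inv hs
  have h3 := h1.congr_of_eventuallyEq h2.symm
  have hinv := hasMFDerivAt_comp_of_eq (hasMFDerivAt_extChartAt_symm hy)
    (hasMFDerivAt_extChartAt hr) rfl
  have hinv' : HasMFDerivAt 𝓘(ℝ, E) 𝓘(ℝ, E)
      ((extChartAt 𝓘(ℝ, E) x₀).symm ∘ extChartAt 𝓘(ℝ, E) x₀) (g r)
      (ContinuousLinearMap.id ℝ E) := by
    refine (hasMFDerivAt_id (g r)).congr_of_eventuallyEq ?_
    filter_upwards [(isOpen_extChartAt_source x₀).mem_nhds hr] with s hs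
    exact (extChartAt 𝓘(ℝ, E) x₀).left_inv hs
  have h4 := hasMFDerivAt_unique hinv hinv'
  refine h3.congr_mfderiv (ContinuousLinearMap.ext_ring ?_)
  have h5 : (mfderiv 𝓘(ℝ, E) 𝓘(ℝ, E) (extChartAt 𝓘(ℝ, E) x₀).symm
      (extChartAt 𝓘(ℝ, E) x₀ (g r)) : E →L[ℝ] E)
        (leftCoord x₀ (extChartAt 𝓘(ℝ, E) x₀ (g r)) (u r)) =
      (mulInvariantVectorField (I := 𝓘(ℝ, E)) (u r) (g r) : E) := by
    refine (congrArg (mfderiv 𝓘(ℝ, E) 𝓘(ℝ, E) (extChartAt 𝓘(ℝ, E) x₀).symm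
      (extChartAt 𝓘(ℝ, E) x₀ (g r)) : E →L[ℝ] E) (leftCoord_apply hr (u r))).trans ?_
    exact congrArg
      (fun L : E →L[ℝ] E ↦ L (mulInvariantVectorField (I := 𝓘(ℝ, E)) (u r) (g r) : E)) h4
  change (mfderiv 𝓘(ℝ, E) 𝓘(ℝ, E) (extChartAt 𝓘(ℝ, E) x₀).symm
    (extChartAt 𝓘(ℝ, E) x₀ (g r)) : E →L[ℝ] E)
      ((1 : ℝ) • leftCoord x₀ (extChartAt 𝓘(ℝ, E) x₀ (g r)) (u r)) =
    (1 : ℝ) • (mulInvariantVectorField (I := 𝓘(ℝ, E)) (u r) (g r) : E)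
  rw [one_smul, one_smul]
  exact h5

end LieGroup

/-! ### Curves with prescribed left velocity -/

/-- `Ad h` as a linear map of the model space. -/
def adjointMap (h : G) : E →L[ℝ] E := Ad h

/-- The tangent vector `dl_h(u)`. -/
def leftField (h : G) (u : E) : E :=
  mulInvariantVectorField (I := 𝓘(ℝ, E)) u h

variable (E) in
/-- The tangent vector `dl_h(u)`, as the derivative of a curve. -/
def leftTangent (h : G) (u : E) : ℝ →L[ℝ] E :=
  (1 : ℝ →L[ℝ] ℝ).smulRight (leftField h u)

theorem leftTangent_one (h : G) (u : E) : leftTangent E h u 1 = leftField h u := one_smul ℝ _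

section Curves

variable [LieGroup 𝓘(ℝ, E) ∞ G] {g : ℝ → G}

theorem hasDerivAt_chart_of_hasMFDerivAt {x₀ : G} {t : ℝ} {L : ℝ →L[ℝ] E}
    (h : HasMFDerivAt 𝓘(ℝ, ℝ) 𝓘(ℝ, E) g t L) (ht : g t ∈ (extChartAt 𝓘(ℝ, E) x₀).source) :
    HasDerivAt (fun s ↦ extChartAt 𝓘(ℝ, E) x₀ (g s))
      ((mfderiv 𝓘(ℝ, E) 𝓘(ℝ, E) (extChartAt 𝓘(ℝ, E) x₀) (g t) : E →L[ℝ] E) (L 1)) t := by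
  have key : ∀ A : E →L[ℝ] E,
      HasMFDerivAt 𝓘(ℝ, E) 𝓘(ℝ, E) (extChartAt 𝓘(ℝ, E) x₀) (g t) A →
      HasDerivAt (fun s ↦ extChartAt 𝓘(ℝ, E) x₀ (g s)) (A (L 1)) t := by
    intro A hA
    have h1 : HasFDerivAt (fun s ↦ extChartAt 𝓘(ℝ, E) x₀ (g s)) (A.comp L) t :=
      (hasMFDerivAt_comp_of_eq hA h rfl).hasFDerivAt
    exact h1.hasDerivAt
  exact key _ (hasMFDerivAt_extChartAt ht)

theorem hasDerivAt_chart {x₀ : G} {t : ℝ} {u : E}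
    (h : HasMFDerivAt 𝓘(ℝ, ℝ) 𝓘(ℝ, E) g t (leftTangent E (g t) u))
    (ht : g t ∈ (extChartAt 𝓘(ℝ, E) x₀).source) :
    HasDerivAt (fun s ↦ extChartAt 𝓘(ℝ, E) x₀ (g s))
      (leftCoord x₀ (extChartAt 𝓘(ℝ, E) x₀ (g t)) u) t := by
  refine (hasDerivAt_chart_of_hasMFDerivAt h ht).congr_deriv ?_
  refine Eq.trans ?_ (leftCoord_apply ht u).symm
  exact congrArg (mfderiv 𝓘(ℝ, E) 𝓘(ℝ, E) (extChartAt 𝓘(ℝ, E) x₀) (g t) : E →L[ℝ] E)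
    (leftTangent_one (g t) u)

/-- Every covector on the Lie algebra is left-translated to a covector at `h`. -/
theorem exists_covector_leftCoord {x₀ h : G} (hh : h ∈ (extChartAt 𝓘(ℝ, E) x₀).source)
    (q : E →L[ℝ] ℝ) :
    ∃ l : E →L[ℝ] ℝ, ∀ w : E, l (leftCoord x₀ (extChartAt 𝓘(ℝ, E) x₀ h) w) = q w := by
  refine ⟨covectorCoord x₀ h (q.comp
    (mfderiv 𝓘(ℝ, E) 𝓘(ℝ, E) (fun x : G ↦ h⁻¹ * x) h : E →L[ℝ] E) : E →L[ℝ] ℝ), fun w ↦ ?_⟩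
  refine (covectorCoord_leftCoord hh _ w).trans ?_
  exact congrArg q (mfderiv_mul_left_inv_mulInvariantVectorField h w)

/-- Every covector on the Lie algebra factors through `leftCoord`, and covectors separate points. -/
theorem leftCoord_injective {x₀ h : G} (hh : h ∈ (extChartAt 𝓘(ℝ, E) x₀).source) :
    Function.Injective (leftCoord x₀ (extChartAt 𝓘(ℝ, E) x₀ h)) := by
  intro v w hvw
  refine (SeparatingDual.eq_iff_forall_dual_eq (R := ℝ)).2 fun q ↦ ?_
  obtain ⟨l, hl⟩ := exists_covector_leftCoord hh q
  rw [← hl, ← hl, hvw]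

theorem leftVelocity_eq {t : ℝ} {u : E}
    (h : HasMFDerivAt 𝓘(ℝ, ℝ) 𝓘(ℝ, E) g t (leftTangent E (g t) u)) :
    (leftVelocity E g t : E) = u := by
  unfold leftVelocity
  rw [h.mfderiv]
  refine Eq.trans ?_ (mfderiv_mul_left_inv_mulInvariantVectorField (g t) u)
  exact congrArg (mfderiv 𝓘(ℝ, E) 𝓘(ℝ, E) (fun x : G ↦ (g t)⁻¹ * x) (g t) : E →L[ℝ] E)
    (leftTangent_one (g t) u)

theorem hasMFDerivAt_leftVelocity {t : ℝ} (h : MDifferentiableAt 𝓘(ℝ, ℝ) 𝓘(ℝ, E) g t) :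
    HasMFDerivAt 𝓘(ℝ, ℝ) 𝓘(ℝ, E) g t (leftTangent E (g t) (leftVelocity E g t)) := by
  refine h.hasMFDerivAt.congr_mfderiv (ContinuousLinearMap.ext_ring ?_)
  refine (mulInvariantVectorField_surjective (g t) _).symm.trans ?_
  exact (leftTangent_one (E := E) (g t) (leftVelocity E g t)).symm

theorem contDiffAt_chart_mul_left (a x₁ : G) {x₀ h : G}
    (hh : h ∈ (extChartAt 𝓘(ℝ, E) x₀).source)
    (hah : a * h ∈ (extChartAt 𝓘(ℝ, E) x₁).source) :
    ContDiffAt ℝ 1 (fun y ↦ extChartAt 𝓘(ℝ, E) x₁ (a * (extChartAt 𝓘(ℝ, E) x₀).symm y))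
      (extChartAt 𝓘(ℝ, E) x₀ h) := by
  refine contDiffAt_infty.1 ?_ 1
  rw [← contMDiffAt_iff_contDiffAt]
  have h1 : ContMDiffAt 𝓘(ℝ, E) 𝓘(ℝ, E) ∞ (extChartAt 𝓘(ℝ, E) x₀).symm
      (extChartAt 𝓘(ℝ, E) x₀ h) := (contMDiffOn_extChartAt_symm x₀).contMDiffAt
    ((isOpen_extChartAt_target x₀).mem_nhds ((extChartAt 𝓘(ℝ, E) x₀).map_source hh))
  have h2 : ContMDiffAt 𝓘(ℝ, E) 𝓘(ℝ, E) ∞ (fun y ↦ a * (extChartAt 𝓘(ℝ, E) x₀).symm y)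
      (extChartAt 𝓘(ℝ, E) x₀ h) := contMDiffAt_const.mul h1
  have h3 : ContMDiffAt 𝓘(ℝ, E) 𝓘(ℝ, E) ∞ (extChartAt 𝓘(ℝ, E) x₁)
      (a * (extChartAt 𝓘(ℝ, E) x₀).symm (extChartAt 𝓘(ℝ, E) x₀ h)) := by
    rw [(extChartAt 𝓘(ℝ, E) x₀).left_inv hh]
    exact contMDiffAt_extChartAt' (by rwa [extChartAt_source] at hah)
  exact ContMDiffAt.comp (g := extChartAt 𝓘(ℝ, E) x₁)
    (f := fun y ↦ a * (extChartAt 𝓘(ℝ, E) x₀).symm y) _ h3 h2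

variable (E) in
/-- `g` is locally absolutely continuous in every chart. -/
def IsLocallyAC (g : ℝ → G) : Prop :=
  Continuous g ∧ ∀ (x₀ : G) (t : ℝ), g t ∈ (extChartAt 𝓘(ℝ, E) x₀).source →
    LocallyAC (fun s ↦ extChartAt 𝓘(ℝ, E) x₀ (g s)) t

theorem IsLocallyAC.mul_left (hg : IsLocallyAC E g) (a : G) : IsLocallyAC E fun t ↦ a * g t := by
  have htop : IsTopologicalGroup G := topologicalGroup_of_lieGroup 𝓘(ℝ, E) ∞
  refine ⟨continuous_const.mul hg.1, fun x₁ t ht ↦ ?_⟩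
  have hsrc := mem_extChartAt_source (I := 𝓘(ℝ, E)) (g t)
  refine ((hg.2 (g t) t hsrc).contDiffAt_comp
    (contDiffAt_chart_mul_left a x₁ hsrc ht)).congr ?_
  filter_upwards [eventually_mem_source (E := E) hg.1 t] with s hs
  rw [(extChartAt 𝓘(ℝ, E) (g t)).left_inv hs]

theorem hasMFDerivAt_mul_left_leftTangent {t : ℝ} {u : E}
    (h : HasMFDerivAt 𝓘(ℝ, ℝ) 𝓘(ℝ, E) g t (leftTangent E (g t) u)) (a : G) :
    HasMFDerivAt 𝓘(ℝ, ℝ) 𝓘(ℝ, E) (fun s ↦ a * g s) t (leftTangent E (a * g t) u) := by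
  refine (hasMFDerivAt_comp_of_eq (hasMFDerivAt_mul_left a (g t)) h rfl).congr_mfderiv
    (ContinuousLinearMap.ext_ring ?_)
  refine Eq.trans ?_ (leftTangent_one (a * g t) u).symm
  refine Eq.trans ?_ (mfderiv_mul_left_mulInvariantVectorField a (g t) u)
  exact congrArg (mfderiv 𝓘(ℝ, E) 𝓘(ℝ, E) (fun x : G ↦ a * x) (g t) : E →L[ℝ] E)
    (leftTangent_one (g t) u)

/-- A curve starting in an open set `V` stays in it as long as it is confined to a closed subset
of `V` until the first exit from `V`. -/
theorem forall_mem_of_no_exit {X : Type*} [TopologicalSpace X] {γ : ℝ → X} (hγ : Continuous γ)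
    {V C : Set X} (hV : IsOpen V) (hC : IsClosed C) (hCV : C ⊆ V) (h0 : γ 0 ∈ V) {b : ℝ}
    (h : ∀ τ ∈ Icc 0 b, (∀ r ∈ Icc 0 τ, γ r ∈ V) → γ τ ∈ C) : ∀ τ ∈ Icc 0 b, γ τ ∈ V := by
  by_contra! hcon
  set A : Set ℝ := Icc 0 b ∩ γ ⁻¹' Vᶜ with hA
  have hAne : A.Nonempty := by
    obtain ⟨τ, hτ, hτV⟩ := hcon
    exact ⟨τ, hτ, hτV⟩
  have hAcl : IsClosed A := isClosed_Icc.inter (hV.isClosed_compl.preimage hγ)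
  have hAbdd : BddBelow A := ⟨0, fun τ hτ ↦ hτ.1.1⟩
  have hm : sInf A ∈ A := hAcl.csInf_mem hAne hAbdd
  set m := sInf A
  have hlt : ∀ τ, 0 ≤ τ → τ < m → γ τ ∈ V := by
    intro τ h1 h2
    by_contra h3
    exact absurd (csInf_le hAbdd ⟨⟨h1, h2.le.trans hm.1.2⟩, h3⟩) (not_le.2 h2)
  have hm0 : 0 < m := by
    refine lt_of_le_of_ne hm.1.1 fun h1 ↦ hm.2 ?_
    rwa [← h1]
  -- Up to the first exit time `m` the curve lies in the closed set `C`, hence so does its limit `γ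
  -- m`.
  have hmem : γ m ∈ C := by
    have hcl : m ∈ closure (Ico 0 m) := by
      rw [closure_Ico hm0.ne]
      exact ⟨hm0.le, le_rfl⟩
    have hsub : Ico 0 m ⊆ γ ⁻¹' C := fun τ hτ ↦
      h τ ⟨hτ.1, hτ.2.le.trans hm.1.2⟩ fun r hr ↦ hlt r hr.1 (hr.2.trans_lt hτ.2)
    exact closure_minimal hsub (hC.preimage hγ) hcl
  exact hm.2 (hCV hmem)

/-- A curve with bounded left velocity is uniformly Lipschitz. -/
theorem isLipschitzCurve_of_ae_hasMFDerivAt [FiniteDimensional ℝ E] (hg : IsLocallyAC E g)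
    {u : ℝ → E} {R : ℝ} (hR : ∀ t, ‖u t‖ ≤ R)
    (hd : ∀ᵐ t : ℝ, HasMFDerivAt 𝓘(ℝ, ℝ) 𝓘(ℝ, E) g t (leftTangent E (g t) (u t))) :
    IsLipschitzCurve E g := by
  have htop : IsTopologicalGroup G := topologicalGroup_of_lieGroup 𝓘(ℝ, E) ∞
  -- A T1 topological group is Hausdorff; this makes the compact set `C` below closed.
  have ht1 : T1Space G := ChartedSpace.t1Space E G
  have hR0 : 0 ≤ R := (norm_nonneg _).trans (hR 0)
  have hunit := unitCoord_mem_target (E := E) (G := G)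
  set φ := extChartAt 𝓘(ℝ, E) (1 : G) with hφ
  obtain ⟨r, hr, hball⟩ : ∃ r > 0, ∀ y, ‖y - unitCoord E G‖ < r →
      y ∈ φ.target ∧ ‖leftCoord (1 : G) y‖ < ‖leftCoord (1 : G) (unitCoord E G)‖ + 1 := by
    have h1 : ∀ᶠ y in 𝓝 (unitCoord E G),
        ‖leftCoord (1 : G) y‖ < ‖leftCoord (1 : G) (unitCoord E G)‖ + 1 :=
      (contDiffAt_leftCoord (1 : G) hunit).continuousAt.norm.eventually_lt continuousAt_const
        (lt_add_one _)
    have h2 : ∀ᶠ y in 𝓝 (unitCoord E G), y ∈ φ.target :=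
      (isOpen_extChartAt_target (1 : G)).mem_nhds hunit
    obtain ⟨r, hr, h3⟩ := Metric.eventually_nhds_iff.1 (h2.and h1)
    exact ⟨r, hr, fun y hy ↦ h3 (by rwa [dist_eq_norm])⟩
  -- A bound for the coordinate speed of every left translate `(g s)⁻¹ * g` while it stays in `V`.
  -- Translates keep the left velocity, so `K` does not depend on `s`.
  set K := (‖leftCoord (1 : G) (unitCoord E G)‖ + 1) * R with hK
  have hK0 : 0 ≤ K := by positivity
  set V : Set G := φ.source ∩ φ ⁻¹' Metric.ball (unitCoord E G) r with hV
  have hVo : IsOpen V := (continuousOn_extChartAt (1 : G)).isOpen_inter_preimage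
    (isOpen_extChartAt_source (1 : G)) Metric.isOpen_ball
  set C : Set G := φ.symm '' Metric.closedBall (unitCoord E G) (r / 2) with hC
  have hCcl : IsClosed C := by
    refine ((isCompact_closedBall _ _).image_of_continuousOn
      ((continuousOn_extChartAt_symm (1 : G)).mono fun y hy ↦ ?_)).isClosed
    rw [mem_closedBall_iff_norm] at hy
    exact (hball y (by linarith)).1
  have hCV : C ⊆ V := by
    rintro _ ⟨y, hy, rfl⟩
    rw [mem_closedBall_iff_norm] at hy
    have hy' := (hball y (by linarith)).1
    refine ⟨φ.map_target hy', ?_⟩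
    rw [mem_preimage, φ.right_inv hy', mem_ball_iff_norm]
    linarith
  have hone : (1 : G) ∈ V := by
    refine ⟨mem_extChartAt_source (1 : G), ?_⟩
    exact Metric.mem_ball_self hr
  have hmean : ∀ s a b : ℝ, a ≤ b → (∀ τ ∈ Icc a b, (g s)⁻¹ * g τ ∈ V) →
      ‖φ ((g s)⁻¹ * g b) - φ ((g s)⁻¹ * g a)‖ ≤ K * (b - a) := by
    intro s a b hab hmem
    refine norm_sub_le_of_locallyAC (f := fun τ ↦ φ ((g s)⁻¹ * g τ)) hab
      (fun τ hτ ↦ (hg.mul_left (g s)⁻¹).2 1 τ (hmem τ hτ).1) ?_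
    filter_upwards [hd] with τ hτ hτab
    refine ⟨_, hasDerivAt_chart (hasMFDerivAt_mul_left_leftTangent hτ (g s)⁻¹) (hmem τ hτab).1, ?_⟩
    refine (ContinuousLinearMap.le_opNorm _ _).trans ?_
    have h1 := (hball _ (mem_ball_iff_norm.1 (hmem τ hτab).2)).2
    exact mul_le_mul h1.le (hR τ) (norm_nonneg _) (by positivity)
  -- In less than this time, at coordinate speed at most `K`, the curve covers at most `r / 2`, so
  -- it stays in `C`. The summand `1` allows for `K = 0`.
  have hε : 0 < r / (2 * (K + 1)) := by positivity
  have hKε : ∀ τ, 0 ≤ τ → τ < r / (2 * (K + 1)) → K * τ ≤ r / 2 := by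
    intro τ h0 h1
    rw [lt_div_iff₀ (by positivity)] at h1
    nlinarith
  have hunit1 : φ 1 = unitCoord E G := rfl
  have hCmem : ∀ h ∈ V, ‖φ h - φ 1‖ ≤ r / 2 → h ∈ C := fun h hh hn ↦
    ⟨φ h, mem_closedBall_iff_norm.2 hn, φ.left_inv hh.1⟩
  refine ⟨K, r / (2 * (K + 1)), hε, fun s t hst ↦ ?_⟩
  suffices hsuff : (∀ τ ∈ uIcc s t, (g s)⁻¹ * g τ ∈ V) by
    refine ⟨(hsuff t right_mem_uIcc).1, ?_⟩
    rcases le_total s t with h | h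
    · rw [uIcc_of_le h] at hsuff
      have := hmean s s t h hsuff
      rwa [inv_mul_cancel, ← abs_of_nonneg (sub_nonneg.2 h)] at this
    · rw [uIcc_of_ge h] at hsuff
      have := hmean s t s h hsuff
      rwa [inv_mul_cancel, norm_sub_rev, ← abs_of_nonneg (sub_nonneg.2 h), abs_sub_comm] at this
  rcases le_total s t with h | h
  · rw [abs_of_nonneg (sub_nonneg.2 h)] at hst
    have := forall_mem_of_no_exit (γ := fun τ ↦ (g s)⁻¹ * g (s + τ))
      (continuous_const.mul (hg.1.comp (by fun_prop))) hVo hCcl hCV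
      (by simpa only [add_zero, inv_mul_cancel] using hone) (b := t - s) ?_
    · intro τ hτ
      rw [uIcc_of_le h] at hτ
      simpa only [add_sub_cancel] using this (τ - s) ⟨by linarith [hτ.1], by linarith [hτ.2]⟩
    · intro τ hτ hV'
      refine hCmem _ (hV' τ ⟨hτ.1, le_rfl⟩) ?_
      have h1 := hmean s s (s + τ) (by linarith [hτ.1]) fun r hr ↦ by
        simpa only [add_sub_cancel] using hV' (r - s) ⟨by linarith [hr.1], by linarith [hr.2]⟩
      rw [inv_mul_cancel, add_sub_cancel_left] at h1
      exact h1.trans (hKε τ hτ.1 (hτ.2.trans_lt hst))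
  · rw [abs_sub_comm, abs_of_nonneg (sub_nonneg.2 h)] at hst
    have := forall_mem_of_no_exit (γ := fun τ ↦ (g s)⁻¹ * g (s - τ))
      (continuous_const.mul (hg.1.comp (by fun_prop))) hVo hCcl hCV
      (by simpa only [sub_zero, inv_mul_cancel] using hone) (b := s - t) ?_
    · intro τ hτ
      rw [uIcc_of_ge h] at hτ
      simpa only [sub_sub_cancel] using this (s - τ) ⟨by linarith [hτ.2], by linarith [hτ.1]⟩
    · intro τ hτ hV'
      refine hCmem _ (hV' τ ⟨hτ.1, le_rfl⟩) ?_
      have h1 := hmean s (s - τ) s (by linarith [hτ.1]) fun r hr ↦ by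
        simpa only [sub_sub_cancel] using hV' (s - r) ⟨by linarith [hr.2], by linarith [hr.1]⟩
      rw [inv_mul_cancel, sub_sub_cancel, norm_sub_rev] at h1
      exact h1.trans (hKε τ hτ.1 (hτ.2.trans_lt hst))

/-- If `q(s)(g(s)⁻¹ g'(s)) = 1` for almost every `s`, where `q` is continuous, and the velocity is
bounded, then the identity holds at every point of differentiability. -/
theorem apply_leftVelocity_eq_one (hg : IsLocallyAC E g)
    {u : ℝ → E} {R : ℝ} (hR : ∀ t, ‖u t‖ ≤ R)
    (hd : ∀ᵐ t : ℝ, HasMFDerivAt 𝓘(ℝ, ℝ) 𝓘(ℝ, E) g t (leftTangent E (g t) (u t)))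
    {q : ℝ → E →L[ℝ] ℝ} (hq : Continuous q) (hq1 : ∀ᵐ t : ℝ, q t (u t) = 1) {t : ℝ}
    (ht : MDifferentiableAt 𝓘(ℝ, ℝ) 𝓘(ℝ, E) g t) : q t (leftVelocity E g t : E) = 1 := by
  have hR0 : 0 ≤ R := (norm_nonneg _).trans (hR 0)
  have hsrc := mem_extChartAt_source (I := 𝓘(ℝ, E)) (g t)
  -- The constant covector `l` in the chart agrees with `q t` at `g t`. Hence `l (x s) - s` has
  -- almost everywhere the derivative `(l ∘ L(x s) - q s)(u s)`, which is small near `t` by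
  -- continuity; the mean value bound then forces its derivative at `t` to be zero.
  obtain ⟨l, hl⟩ := exists_covector_leftCoord hsrc (q t)
  set x : ℝ → E := fun s ↦ extChartAt 𝓘(ℝ, E) (g t) (g s) with hx
  have hxd : HasDerivAt (fun s ↦ l (x s) - s) (q t (leftVelocity E g t : E) - 1) t := by
    have h1 := hasDerivAt_chart (hasMFDerivAt_leftVelocity ht) hsrc
    have h2 : HasDerivAt (fun s ↦ l (x s))
      (l (leftCoord (g t) (x t) (leftVelocity E g t : E))) t := l.hasFDerivAt.comp_hasDerivAt t h1
    have h3 := h2.sub (hasDerivAt_id t)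
    exact h3.congr_deriv (congrArg (· - 1) (hl (leftVelocity E g t)))
  suffices hzero : HasDerivAt (fun s ↦ l (x s) - s) 0 t by
    linarith [hxd.unique hzero]
  rw [hasDerivAt_iff_isLittleO, Asymptotics.isLittleO_iff]
  intro c hc
  have hNc : ContinuousAt (fun s ↦ l.comp (leftCoord (g t) (x s)) - q s) t := by
    refine ContinuousAt.sub ?_ hq.continuousAt
    refine ContinuousAt.clm_comp continuousAt_const ?_
    refine ContinuousAt.comp (g := leftCoord (g t)) ?_ (hg.2 (g t) t hsrc).continuousAt
    exact (contDiffAt_leftCoord (g t)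
      ((extChartAt 𝓘(ℝ, E) (g t)).map_source hsrc)).continuousAt
  have hN0 : l.comp (leftCoord (g t) (x t)) - q t = 0 := by
    ext w
    exact sub_eq_zero.2 (hl w)
  have hNev : ∀ᶠ s in 𝓝 t, ‖l.comp (leftCoord (g t) (x s)) - q s‖ < c / (R + 1) := by
    refine hNc.norm.eventually_lt continuousAt_const ?_
    rw [hN0, norm_zero]
    positivity
  obtain ⟨δ, hδ, hball⟩ := Metric.eventually_nhds_iff.1
    (hNev.and (eventually_mem_source (E := E) hg.1 t))
  have hACf : ∀ s, dist s t < δ → LocallyAC (fun s ↦ l (x s) - s) s := by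
    intro s hs
    have h1 := hg.2 (g t) s (hball hs).2
    have h2 : LocallyAC (fun s : ℝ ↦ s) s :=
      ⟨1, one_pos, (LipschitzWith.id.lipschitzOnWith).absolutelyContinuousOnInterval⟩
    exact (h1.prodMk h2).contDiffAt_comp (F := fun p : E × ℝ ↦ l p.1 - p.2)
      (ContDiff.contDiffAt (by fun_prop))
  have hdf : ∀ᵐ s : ℝ, dist s t < δ →
      ∃ f', HasDerivAt (fun s ↦ l (x s) - s) f' s ∧ ‖f'‖ ≤ c := by
    filter_upwards [hd, hq1] with s hs hs1 hst
    obtain ⟨hb, hmem⟩ := hball hst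
    have h2 : HasDerivAt (fun s ↦ l (x s)) (l (leftCoord (g t) (x s) (u s))) s :=
      l.hasFDerivAt.comp_hasDerivAt s (hasDerivAt_chart hs hmem)
    refine ⟨_, h2.sub (hasDerivAt_id s), ?_⟩
    have h3 : l (leftCoord (g t) (x s) (u s)) - 1 =
        (l.comp (leftCoord (g t) (x s)) - q s) (u s) := by simp [hs1]
    rw [h3]
    refine (ContinuousLinearMap.le_opNorm _ _).trans ?_
    calc _ ≤ c / (R + 1) * R := mul_le_mul hb.le (hR s) (norm_nonneg _) (by positivity)
      _ ≤ c / (R + 1) * (R + 1) := by gcongr; linarith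
      _ = c := div_mul_cancel₀ _ (by positivity)
  filter_upwards [Metric.ball_mem_nhds t hδ] with s hs
  rw [smul_zero, sub_zero]
  have hs' : |s - t| < δ := by rwa [Metric.mem_ball, Real.dist_eq] at hs
  rw [abs_lt] at hs'
  rcases le_total t s with h | h
  · have := norm_sub_le_of_locallyAC (f := fun s ↦ l (x s) - s) (K := c) h
      (fun r hr ↦ hACf r (by
        rw [Real.dist_eq, abs_lt]; constructor <;> linarith [hr.1, hr.2]))
      (by
        filter_upwards [hdf] with r h1 hr
        refine h1 ?_
        rw [Real.dist_eq, abs_lt]; constructor <;> linarith [hr.1, hr.2])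
    rwa [Real.norm_of_nonneg (sub_nonneg.2 h)]
  · have := norm_sub_le_of_locallyAC (f := fun s ↦ l (x s) - s) (K := c) h
      (fun r hr ↦ hACf r (by
        rw [Real.dist_eq, abs_lt]; constructor <;> linarith [hr.1, hr.2]))
      (by
        filter_upwards [hdf] with r h1 hr
        refine h1 ?_
        rw [Real.dist_eq, abs_lt]; constructor <;> linarith [hr.1, hr.2])
    rwa [norm_sub_rev s t, Real.norm_of_nonneg (sub_nonneg.2 h), norm_sub_rev]

/-- If the velocities of `g` are normalized by a covector depending only on the position, then
for almost every `t` all velocities at the position `g t` coincide with the one at time `t`. -/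
theorem ae_forall_velocity_eq {u : ℝ → E} {q : G → E →L[ℝ] ℝ} {T : Set ℝ}
    (hT : ∀ t ∈ T, HasMFDerivAt 𝓘(ℝ, ℝ) 𝓘(ℝ, E) g t (leftTangent E (g t) (u t)) ∧
      q (g t) (u t) = 1) :
    ∀ᵐ t : ℝ, t ∈ T → ∀ s ∈ T, g s = g t → u s = u t := by
  have hS : {p : ℝ × ℝ | p.1 ∈ T ∧ p.2 ∈ T ∧ g p.1 = g p.2 ∧ u p.1 ≠ u p.2}.Countable := by
    refine countable_transverse_selfIntersections (V := E) (g := g) ?_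
    rintro ⟨s, t⟩ ⟨hs, ht, hst, hne⟩
    dsimp only at hs ht hst hne ⊢
    have hsrc := mem_extChartAt_source (I := 𝓘(ℝ, E)) (g s)
    have hd1 := hasDerivAt_chart (hT s hs).1 hsrc
    have hd2 := hasDerivAt_chart (x₀ := g s) (hT t ht).1 (by rw [← hst]; exact hsrc)
    refine ⟨hst, extChartAt 𝓘(ℝ, E) (g s), _, _, hd1, hd2, fun a b hab ↦ ?_⟩
    rw [← hst, ← map_smul, ← map_smul] at hab
    -- The relation becomes `a • u s = b • u t`; the common covector has value 1 on both vectors, so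
    -- `a = b`, and then `u s ≠ u t` forces `a = 0`.
    have h1 := leftCoord_injective hsrc hab
    have h2 := congrArg (q (g s)) h1
    rw [map_smul, map_smul, (hT s hs).2, hst, (hT t ht).2, smul_eq_mul, smul_eq_mul, mul_one,
      mul_one] at h2
    subst h2
    have ha : a = 0 := by
      by_contra ha
      exact hne (smul_right_injective E ha h1)
    exact ⟨ha, ha⟩
  have h0 := (hS.image Prod.fst).ae_notMem (volume : Measure ℝ)
  filter_upwards [h0] with t ht htT s hs hst
  by_contra hne
  exact ht ⟨(t, s), ⟨htT, hs, hst.symm, fun h ↦ hne h.symm⟩, rfl⟩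

end Curves

/-! ### Normalized momenta of normal extremals -/

/-- `ψ₀` is the momentum at the unit of the curve `g` with control `u`, normalized so that the
maximal value of the Hamiltonian is `1`. -/
structure IsNormalizedMomentum (D : LeftInvariantMetric E G) (g : ℝ → G) (u : ℝ → E)
    (ψ₀ : E →L[ℝ] ℝ) : Prop where
  locallyAC : IsLocallyAC E g
  control_mem : ∀ t, u t ∈ D.controlSet
  hasMFDerivAt : ∀ᵐ t : ℝ, HasMFDerivAt 𝓘(ℝ, ℝ) 𝓘(ℝ, E) g t (leftTangent E (g t) (u t))
  le_one : ∀ t, ∀ w ∈ D.controlSet, ψ₀ (adjointMap (g t) w) ≤ 1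
  eq_one : ∀ᵐ t : ℝ, ψ₀ (adjointMap (g t) (u t)) = 1
  supportFunction_eq_one : ∀ t, supportFunction D.controlSet (ψ₀.comp (adjointMap (g t))) = 1
  continuous_momentum : Continuous fun t ↦ ψ₀.comp (adjointMap (g t))

/-- `ψ₀` is the constant space momentum divided by the constant maximal value `c` of the
Hamiltonian; composed with `Ad(g(t))` it is the body momentum divided by `c`. -/
theorem IsNormalExtremal.exists_normalizedMomentum [LieGroup 𝓘(ℝ, E) ∞ G]
    [FiniteDimensional ℝ E] {D : LeftInvariantMetric E G} {g : ℝ → G}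
    (hg : IsNormalExtremal D g) : ∃ u ψ₀, IsNormalizedMomentum D g u ψ₀ := by
  obtain ⟨(u : ℝ → E), ψ, h, hpos⟩ := hg
  have hU := D.isCompact_controlSet
  set c := supportFunction D.controlSet (bodyMomentum (g 0) (ψ 0)) with hc
  have hconst : ∀ t, supportFunction D.controlSet (bodyMomentum (g t) (ψ t)) = c := fun t ↦
    h.supportFunction_bodyMomentum_eq t 0
  have hmax : ∀ᵐ t : ℝ, bodyMomentum (g t) (ψ t) (u t) = c := by
    filter_upwards [h.maximum] with t ht
    have h1 : supportFunction D.controlSet (bodyMomentum (g t) (ψ t)) =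
        bodyMomentum (g t) (ψ t) (u t) := supportFunction_eq_of_isMaxOn (h.control_mem t) ht
    rw [← hconst t, h1]
  -- Since `c` does not depend on time, positivity at a single time suffices.
  have hcpos : 0 < c := by
    obtain ⟨t, h1, h2⟩ := (hmax.and hpos).exists
    rw [← h1]
    exact h2
  have hAd : ∀ t (w : E), (c⁻¹ • spaceMomentum (g 0) (ψ 0)) (adjointMap (g t) w) =
      c⁻¹ * bodyMomentum (g t) (ψ t) w := by
    intro t w
    have h1 : bodyMomentum (g t) (ψ t) w = spaceMomentum (g t) (ψ t) (adjointMap (g t) w) :=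
      bodyMomentum_eq_spaceMomentum_Ad (g t) (ψ t) w
    rw [h1, h.spaceMomentum_eq t 0]
    rfl
  have hAd' : ∀ t, (c⁻¹ • spaceMomentum (g 0) (ψ 0)).comp (adjointMap (g t)) =
      c⁻¹ • bodyMomentum (g t) (ψ t) := fun t ↦ ContinuousLinearMap.ext (hAd t)
  have hle : ∀ t, ∀ w ∈ D.controlSet,
      (c⁻¹ • spaceMomentum (g 0) (ψ 0)) (adjointMap (g t) w) ≤ 1 := by
    intro t w hw
    rw [hAd, inv_mul_le_iff₀ hcpos, mul_one, ← hconst t]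
    exact apply_le_supportFunction hU _ hw
  refine ⟨u, c⁻¹ • spaceMomentum (g 0) (ψ 0), ⟨h.absolutelyContinuous.1, fun x₀ t ht ↦
    (h.absolutelyContinuous.locallyAC ht).1⟩, h.control_mem, h.ae_hasMFDerivAt, hle, ?_, ?_, ?_⟩
  · filter_upwards [hmax] with t ht
    rw [hAd, ht, inv_mul_cancel₀ hcpos.ne']
  · intro t
    obtain ⟨w, hw, hwmax⟩ := hU.exists_isMaxOn ⟨0, D.zero_mem_controlSet⟩
      (bodyMomentum (g t) (ψ t)).continuous.continuousOn
    have h1 : bodyMomentum (g t) (ψ t) w = c := by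
      rw [← supportFunction_eq_of_isMaxOn hw hwmax, hconst]
    rw [supportFunction_eq_of_isMaxOn hw]
    · rw [ContinuousLinearMap.comp_apply, hAd, h1, inv_mul_cancel₀ hcpos.ne']
    · intro w' hw'
      refine (hle t w' hw').trans_eq ?_
      rw [ContinuousLinearMap.comp_apply, hAd, h1, inv_mul_cancel₀ hcpos.ne']
  · simp_rw [hAd']
    refine continuous_iff_continuousAt.2 fun t ↦ ?_
    exact (h.locallyAC_bodyMomentum t).continuousAt.const_smul c⁻¹

end Momentum

end SubFinsler

end

/-! ### The main theorem. -/

theorem theorem3 {E : Type*} [NormedAddCommGroup E] [NormedSpace ℝ E] [FiniteDimensional ℝ E]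
    {G : Type*} [TopologicalSpace G] [ChartedSpace E G] [Group G] [LieGroup 𝓘(ℝ, E) ∞ G]
    (D : SubFinsler.LeftInvariantMetric E G) (g : ℝ → G)
    (hg : SubFinsler.IsNormalExtremal D g) (hg0 : g 0 = 1) :
    -- the curve is parametrized by arc length: `F(g⁻¹ g') = 1` almost everywhere
    (∀ᵐ t : ℝ, ∃ h : SubFinsler.leftVelocity E g t ∈ D.p,
      D.F ⟨SubFinsler.leftVelocity E g t, h⟩ = 1) ∧
    ∃ ψ₀ : GroupLieAlgebra 𝓘(ℝ, E) G →L[ℝ] ℝ,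
      IsGreatest (ψ₀ '' D.unitBall) 1 ∧
      -- 1: for some choice `w` of maximizers, `g` is a Lipschitz integral curve of `v`
      (∃ w : G → GroupLieAlgebra 𝓘(ℝ, E) G,
        (∀ h : G, w h ∈ D.unitBall ∧
          IsMaxOn (fun x ↦ ψ₀ (SubFinsler.Ad h x)) D.unitBall (w h)) ∧
        SubFinsler.IsLipschitzIntegralCurve g
          (fun h ↦ mulInvariantVectorField (ψ₀ (SubFinsler.Ad h (w h)) • w h) h)) ∧
      -- 2: the conservation law for `ψ(t) = Ad(g(t))* ψ₀`
      ∀ t : ℝ, MDifferentiableAt 𝓘(ℝ, ℝ) 𝓘(ℝ, E) g t →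
        (ψ₀.comp (SubFinsler.Ad (g t))) (SubFinsler.leftVelocity E g t) = 1 := by
  open SubFinsler in
  obtain ⟨u, ψ₀, h⟩ := hg.exists_normalizedMomentum
  have hU := D.isCompact_controlSet
  obtain ⟨R, hR⟩ := hU.isBounded.exists_norm_le
  have huR : ∀ t, ‖u t‖ ≤ R := fun t ↦ hR _ (h.control_mem t)
  have hmaxi : ∀ k : G, ∃ w ∈ D.controlSet, IsMaxOn (ψ₀.comp (adjointMap k)) D.controlSet w :=
    fun k ↦ hU.exists_isMaxOn ⟨0, D.zero_mem_controlSet⟩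
      (ψ₀.comp (adjointMap k)).continuous.continuousOn
  refine ⟨?_, ψ₀, ?_, ?_, ?_⟩
  · filter_upwards [h.hasMFDerivAt, h.eq_one] with t ht h1
    have hv : leftVelocity E g t = u t := leftVelocity_eq ht
    rw [hv]
    refine D.F_eq_one_of_isMaxOn (q := ψ₀.comp (adjointMap (g t))) (h.control_mem t) ?_ ?_
    · intro w hw
      exact (h.le_one t w hw).trans_eq h1.symm
    · exact zero_lt_one.trans_eq h1.symm
  · obtain ⟨w, hw, hwmax⟩ := hmaxi (g 0)
    have h1 := h.supportFunction_eq_one 0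
    rw [supportFunction_eq_of_isMaxOn hw hwmax] at h1
    -- The curve starts at the unit, where `Ad` is the identity; the normalization at time 0 is thus
    -- one of `ψ₀` itself.
    have h2 : ∀ w, ψ₀ (adjointMap (g 0) w) = ψ₀ w := fun w ↦ by
      rw [hg0]
      exact congrArg (fun L : E →L[ℝ] E ↦ ψ₀ (L w)) Ad_one
    refine ⟨⟨w, hw, (h2 w).symm.trans h1⟩, ?_⟩
    rintro _ ⟨w', hw', rfl⟩
    exact (h2 w').symm.trans_le (h.le_one 0 w' hw')
  · set T : Set ℝ := {t | HasMFDerivAt 𝓘(ℝ, ℝ) 𝓘(ℝ, E) g t (leftTangent E (g t) (u t)) ∧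
      ψ₀.comp (adjointMap (g t)) (u t) = 1} with hT
    -- At a point visited at a good time, the control at one such time is chosen; elsewhere any
    -- maximizer will do.
    have hw : ∀ k : G, ∃ w ∈ D.controlSet, IsMaxOn (ψ₀.comp (adjointMap k)) D.controlSet w ∧
        ((∃ t ∈ T, g t = k) → ∃ t ∈ T, g t = k ∧ u t = w) := by
      intro k
      by_cases hk : ∃ t ∈ T, g t = k
      · obtain ⟨t, ht, rfl⟩ := hk
        refine ⟨u t, h.control_mem t, fun w hw ↦ ?_, fun _ ↦ ⟨t, ht, rfl, rfl⟩⟩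
        exact (h.le_one t w hw).trans_eq ht.2.symm
      · obtain ⟨w, hw, hwmax⟩ := hmaxi k
        exact ⟨w, hw, hwmax, fun h ↦ absurd h hk⟩
    choose w hwU hwmax hwT using hw
    refine ⟨w, fun k ↦ ⟨hwU k, hwmax k⟩,
      isLipschitzCurve_of_ae_hasMFDerivAt h.locallyAC huR h.hasMFDerivAt, ?_⟩
    filter_upwards [ae_forall_velocity_eq (q := fun k ↦ ψ₀.comp (adjointMap k)) (T := T)
      (fun t ht ↦ ht), h.hasMFDerivAt, h.eq_one] with t hvel hd h1
    have htT : t ∈ T := ⟨hd, h1⟩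
    obtain ⟨s, hs, hgs, hus⟩ := hwT (g t) ⟨t, htT, rfl⟩
    have hwt : w (g t) = u t := hus.symm.trans (hvel htT s hs hgs)
    -- The scalar factor of the vector field equals 1 along the curve.
    have h2 : ψ₀ (adjointMap (g t) (w (g t))) • w (g t) = u t := by
      rw [hwt, h1, one_smul]
    exact hd.congr_mfderiv (congrArg (leftTangent E (g t)) h2.symm)
  · intro t ht
    exact apply_leftVelocity_eq_one h.locallyAC huR h.hasMFDerivAt h.continuous_momentum h.eq_one ht
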